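/- Let $R$ be a commutative ring; modules are $R$-modules. A module $M$ is Mittag-Leffler if for every family of modules $(N_i)_{i\in I}$ the canonical map $M\otimes_R\prod_{i}N_i\to\prod_{i}(M\otimes_R N_i)$ is injective. For an infinite cardinal $\kappa$, a module is $\le\kappa$-presented if it is the cokernel of a homomorphism between free modules of rank $\le\kappa$. Let $\mathcal A(\kappa)$ be the class of $\kappa$-restricted flat Mittag-Leffler modules, i.e. of modules $M$ that admit a chain of submodules $(M_\alpha\mid\alpha\le\sigma)$, indexed by an ordinal $\sigma$, with $M_\alpha\subseteq M_\beta$ for $\alpha\le\beta\le\sigma$, $M_0=0$, $M_\sigma=M$, $M_\beta=\bigcup_{\alpha<\beta}M_\alpha$ for limit ordinals $\beta\le\sigma$, and $M_{\alpha+1}/M_\alpha$ a $\le\kappa$-presented flat Mittag-Leffler module for every $\alpha<\sigma$. For a class $\mathcal C$ of modules, a module $M$ is $\mathcal C$-periodic if there is a short exact sequence $0\to M\to C\to M\to 0$ with $C\in\mathcal C$. A ($\mathbb Z$-indexed) chain complex $C_\bullet$ with cycles $Z_n=\operatorname{Ker}(C_n\to C_{n-1})$ is pure acyclic if it is acyclic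 and every $Z_n$ is a pure submodule of $C_n$ (i.e. $N\otimes_R Z_n\to N\otimes_R C_n$ is injective for every module $N$). For every infinite cardinal $\kappa$: 1. every flat $\mathcal A(\kappa)$-periodic module belongs to $\mathcal A(\kappa)$; 2. every pure acyclic complex with all components in $\mathcal A(\kappa)$ has all its cycles in $\mathcal A(\kappa)$. Moreover, $\mathcal A(\aleph_0)$ is exactly the class of projective modules. Hence (Benson–Goodearl) every flat module $M$ that admits a short exact sequence $0\to M\to P\to M\to 0$ with $P$ projective is projective, and every pure acyclic complex of projective modules has projective cycles and is contractible. -/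

import Mathlib

open CategoryTheory
open scoped TensorProduct Cardinal

universe u

namespace RestrictedFlatML

variable (R : Type u) [CommRing R]

/-- `M` is Mittag-Leffler: for every family of modules `(N i)`, the canonical map
`M ⊗ ∏ i, N i → ∏ i, M ⊗ N i` is injective. -/
def IsMittagLeffler (M : Type u) [AddCommGroup M] [Module R M] : Prop :=
  ∀ (I : Type u) (N : I → Type u) [∀ i, AddCommGroup (N i)] [∀ i, Module R (N i)],
    Function.Injective (TensorProduct.piRightHom R R M N)

/-- `M` is `≤ κ`-presented: it is the cokernel of a map between free modules of rank `≤ κ`. -/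
def IsLEPresented (κ : Cardinal.{u}) (M : Type u) [AddCommGroup M] [Module R M] : Prop :=
  ∃ (I J : Type u) (f : (J →₀ R) →ₗ[R] (I →₀ R)) (g : (I →₀ R) →ₗ[R] M),
    #I ≤ κ ∧ #J ≤ κ ∧ Function.Exact f g ∧ Function.Surjective g

/-- The class of flat modules. -/
def flatModules : ObjectProperty (ModuleCat.{u} R) :=
  fun M => Module.Flat R M

/-- The class of projective modules. -/
def projectiveModules : ObjectProperty (ModuleCat.{u} R) :=
  fun M => Module.Projective R M

/-- The class of `≤ κ`-presented flat Mittag-Leffler modules. -/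
def presentedFlatML (κ : Cardinal.{u}) : ObjectProperty (ModuleCat.{u} R) :=
  fun M => IsLEPresented R κ M ∧ Module.Flat R M ∧ IsMittagLeffler R M

variable {R}

/-- The class of `S`-filtered modules: `M` is the union of a continuous well-ordered chain
`(F α | α ≤ σ)` of submodules starting at `0` whose consecutive factors are isomorphic
to modules in `S`. -/
def filt (S : ObjectProperty (ModuleCat.{u} R)) : ObjectProperty (ModuleCat.{u} R) :=
  fun M => ∃ (σ : Ordinal.{u}) (F : Ordinal.{u} → Submodule R M),
    MonotoneOn F (Set.Iic σ) ∧ F 0 = ⊥ ∧ F σ = ⊤ ∧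
    (∀ β ≤ σ, Order.IsSuccLimit β → F β = ⨆ α : Set.Iio β, F α) ∧
    ∀ α < σ, ∃ N : ModuleCat.{u} R, S N ∧
      Nonempty ((F (Order.succ α) ⧸ (F α).submoduleOf (F (Order.succ α))) ≃ₗ[R] N)

variable (R) in
/-- The class `A(κ)` of `κ`-restricted flat Mittag-Leffler modules: modules filtered by
`≤ κ`-presented flat Mittag-Leffler modules. -/
def restrictedFlatML (κ : Cardinal.{u}) : ObjectProperty (ModuleCat.{u} R) :=
  filt (presentedFlatML R κ)

/-- `M` is `A`-periodic: there is a short exact sequence `0 → M → C → M → 0` with `C` in `A`. -/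
def IsPeriodic (A : ObjectProperty (ModuleCat.{u} R)) (M : ModuleCat.{u} R) : Prop :=
  ∃ (C : ModuleCat.{u} R) (f : M →ₗ[R] C) (g : C →ₗ[R] M),
    A C ∧ Function.Injective f ∧ Function.Exact f g ∧ Function.Surjective g

/-- `P` is a pure submodule of `M`: tensoring the inclusion with any module keeps it injective. -/
def IsPureSubmodule {M : Type u} [AddCommGroup M] [Module R M] (P : Submodule R M) : Prop :=
  ∀ (N : Type u) [AddCommGroup N] [Module R N], Function.Injective (P.subtype.lTensor N)

/-- The module of `n`-cycles `Z n = Ker (d n : C n → C (n - 1))`, as a submodule of `C n`. -/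
def cycles (C : ChainComplex (ModuleCat.{u} R) ℤ) (n : ℤ) : Submodule R (C.X n) :=
  LinearMap.ker (C.d n (n - 1)).hom

/-- A complex is pure acyclic if it is acyclic and all the short exact sequences
`0 → Z n → C n → Z (n - 1) → 0` are pure. -/
def IsPureAcyclic (C : ChainComplex (ModuleCat.{u} R) ℤ) : Prop :=
  C.Acyclic ∧ ∀ n, IsPureSubmodule (cycles C n)

end RestrictedFlatML

/-!
A periodic module and a pure acyclic complex are both instances of a family of short exact
sequences `0 → Z (n + 1) → C (n + 1) → Z n → 0`, indexed by `ℤ`, with `Z n` flat and `C n` in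
`A(κ)`. Hill's lemma expands a filtration of `C n` to a family of submodules which is closed under
sums, has enough small members, and whose members have flat Mittag-Leffler quotients. A countable
closing-off argument puts each small family of submodules of the `C n` inside a small family of
members of these Hill families which induces exact subsequences with pure cycles. The cycles are
pure in flat Mittag-Leffler modules, hence themselves flat Mittag-Leffler, and `κ`-generated flat
Mittag-Leffler modules are `κ`-presented because the inclusion of a finitely generated submodule
factors through a finite free module so that the first map factors through that of every other such
factorization. Passing to the quotients and iterating transfinitely filters all the `Z n`
simultaneously.

A countably presented flat Mittag-Leffler module is projective, and so is any module filtered by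
such modules. Conversely, a projective module is a direct summand of a free module, hence a cycle
module of a `2`-periodic complex with free components.
-/

namespace RestrictedFlatML

variable {R : Type u} [CommRing R]

section Purity

variable {A B Q : Type u} [AddCommGroup A] [Module R A] [AddCommGroup B] [Module R B]
  [AddCommGroup Q] [Module R Q]

theorem lTensor_rTensor_comm {X Y : Type u} [AddCommGroup X] [Module R X] [AddCommGroup Y]
    [Module R Y] (f : A →ₗ[R] B) (g : X →ₗ[R] Y) (t : A ⊗[R] X) :
    g.lTensor B (f.rTensor X t) = f.rTensor Y (g.lTensor A t) := by
  rw [← LinearMap.comp_apply, ← LinearMap.comp_apply, LinearMap.lTensor_comp_rTensor,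
    LinearMap.rTensor_comp_lTensor]

/-- A linear map is a pure monomorphism if it stays injective after tensoring with any module. -/
def IsPureInjective (f : A →ₗ[R] B) : Prop :=
  ∀ (N : Type u) [AddCommGroup N] [Module R N], Function.Injective (f.rTensor N)

theorem isPureSubmodule_iff {P : Submodule R B} :
    IsPureSubmodule P ↔ IsPureInjective P.subtype := by
  simp only [IsPureSubmodule, IsPureInjective, LinearMap.lTensor_inj_iff_rTensor_inj]

theorem IsPureInjective.comp {f : A →ₗ[R] B} {g : B →ₗ[R] Q} (hg : IsPureInjective g)
    (hf : IsPureInjective f) : IsPureInjective (g ∘ₗ f) := fun N _ _ => by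
  rw [LinearMap.rTensor_comp]
  exact (hg N).comp (hf N)

theorem IsPureInjective.of_comp {f : A →ₗ[R] B} {g : B →ₗ[R] Q}
    (h : IsPureInjective (g ∘ₗ f)) : IsPureInjective f := fun N _ _ => by
  have hN := h N
  rw [LinearMap.rTensor_comp] at hN
  exact Function.Injective.of_comp hN

theorem isPureInjective_of_comp_eq_id {f : A →ₗ[R] B} {g : B →ₗ[R] A}
    (h : g ∘ₗ f = LinearMap.id) : IsPureInjective f := by
  refine IsPureInjective.of_comp (g := g) fun N _ _ => ?_
  rw [h, LinearMap.rTensor_id]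
  exact Function.injective_id

theorem isPureInjective_equiv (e : A ≃ₗ[R] B) : IsPureInjective e.toLinearMap :=
  isPureInjective_of_comp_eq_id e.symm_comp

theorem rTensor_injective_of_exact {f : A →ₗ[R] B} {g : B →ₗ[R] Q} (hfg : Function.Exact f g)
    (hg : Function.Surjective g) {K F N : Type u} [AddCommGroup K] [Module R K] [AddCommGroup F]
    [Module R F] [AddCommGroup N] [Module R N] {ι : K →ₗ[R] F} {π : F →ₗ[R] N}
    (hιπ : Function.Exact ι π) (hπ : Function.Surjective π)
    (hf : Function.Injective (f.rTensor F)) (hι : Function.Injective (ι.lTensor Q)) :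
    Function.Injective (f.rTensor N) := by
  rw [injective_iff_map_eq_zero]
  intro x hx
  obtain ⟨y, rfl⟩ := LinearMap.lTensor_surjective A hπ x
  obtain ⟨k, hk⟩ := (lTensor_exact B hιπ hπ _).1 ((lTensor_rTensor_comm f π y).trans hx)
  have hgk : g.rTensor K k = 0 := by
    apply hι
    rw [map_zero, lTensor_rTensor_comm, hk]
    exact (rTensor_exact F hfg hg _).2 ⟨y, rfl⟩
  obtain ⟨a, rfl⟩ := (rTensor_exact K hfg hg _).1 hgk
  have ha : ι.lTensor A a = y := hf (by rw [← hk, lTensor_rTensor_comm])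
  exact (lTensor_exact A hιπ hπ _).2 ⟨a, ha⟩

theorem isPureInjective_of_flat {f : A →ₗ[R] B} {g : B →ₗ[R] Q} (hf : Function.Injective f)
    (hfg : Function.Exact f g) (hg : Function.Surjective g) [Module.Flat R Q] :
    IsPureInjective f := by
  intro N _ _
  have hπ : Function.Surjective (Finsupp.linearCombination R (id : N → N)) :=
    Finsupp.linearCombination_id_surjective R N
  exact rTensor_injective_of_exact hfg hg (LinearMap.exact_subtype_ker_map _) hπ
    (Module.Flat.rTensor_preserves_injective_linearMap f hf)
    (Module.Flat.lTensor_preserves_injective_linearMap _ (Submodule.subtype_injective _))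

theorem flat_of_isPureInjective [Module.Flat R B] {f : A →ₗ[R] B} {g : B →ₗ[R] Q}
    (hf : IsPureInjective f) (hfg : Function.Exact f g) (hg : Function.Surjective g) :
    Module.Flat R Q := by
  refine Module.Flat.iff_lTensor_injective'.2 fun J => ?_
  rw [LinearMap.lTensor_inj_iff_rTensor_inj]
  exact rTensor_injective_of_exact (LinearMap.exact_subtype_mkQ J) J.mkQ_surjective hfg hg
    (Module.Flat.rTensor_preserves_injective_linearMap _ J.subtype_injective)
    ((LinearMap.lTensor_inj_iff_rTensor_inj _ _).2 (hf _))

theorem isPureInjective_subtype_iff_flat_quotient [Module.Flat R B] {P : Submodule R B} :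
    IsPureInjective P.subtype ↔ Module.Flat R (B ⧸ P) :=
  ⟨fun h => flat_of_isPureInjective h (LinearMap.exact_subtype_mkQ P) P.mkQ_surjective,
    fun _ => isPureInjective_of_flat P.subtype_injective (LinearMap.exact_subtype_mkQ P)
      P.mkQ_surjective⟩

end Purity

section FlatMittagLeffler

variable {A B Q : Type u} [AddCommGroup A] [Module R A] [AddCommGroup B] [Module R B]
  [AddCommGroup Q] [Module R Q]

variable (R) in
/-- Flat Mittag-Leffler modules. -/
def IsFlatML (M : Type u) [AddCommGroup M] [Module R M] : Prop :=
  Module.Flat R M ∧ IsMittagLeffler R M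

/-- The kernels of the maps `φ i` have zero intersection. Flat Mittag-Leffler modules are those
for which tensoring preserves this property, see `isFlatML_iff_jointlyInjective`. -/
def JointlyInjective {I X : Type u} [AddCommGroup X] [Module R X] {N : I → Type u}
    [∀ i, AddCommGroup (N i)] [∀ i, Module R (N i)] (φ : ∀ i, X →ₗ[R] N i) : Prop :=
  ∀ x, (∀ i, φ i x = 0) → x = 0

section JointlyInjective

variable {I X : Type u} [AddCommGroup X] [Module R X] {N : I → Type u}
  [∀ i, AddCommGroup (N i)] [∀ i, Module R (N i)] {φ : ∀ i, X →ₗ[R] N i}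

theorem JointlyInjective.of_isPureInjective (hB : JointlyInjective fun i => (φ i).lTensor B)
    {f : A →ₗ[R] B} (hf : IsPureInjective f) : JointlyInjective fun i => (φ i).lTensor A := by
  refine fun t ht => hf X ?_
  rw [map_zero]
  exact hB _ fun i => by rw [lTensor_rTensor_comm, ht, map_zero]

theorem JointlyInjective.of_exact (hA : JointlyInjective fun i => (φ i).lTensor A)
    (hQ : JointlyInjective fun i => (φ i).lTensor Q) {f : A →ₗ[R] B} {g : B →ₗ[R] Q}
    (hf : IsPureInjective f) (hfg : Function.Exact f g) (hg : Function.Surjective g) :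
    JointlyInjective fun i => (φ i).lTensor B := by
  intro t ht
  have hgt : g.rTensor X t = 0 := hQ _ fun i => by rw [lTensor_rTensor_comm, ht, map_zero]
  obtain ⟨a, rfl⟩ := (rTensor_exact X hfg hg _).1 hgt
  rw [hA a fun i => hf (N i) (by rw [← lTensor_rTensor_comm, ht, map_zero]), map_zero]

end JointlyInjective

theorem piRightHom_apply {M I : Type u} [AddCommGroup M] [Module R M] {N : I → Type u}
    [∀ i, AddCommGroup (N i)] [∀ i, Module R (N i)] (t : M ⊗[R] (∀ i, N i)) (i : I) :
    TensorProduct.piRightHom R R M N t i =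
      (LinearMap.proj i : (∀ i, N i) →ₗ[R] N i).lTensor M t := by
  induction t with
  | zero => simp
  | tmul m n => simp
  | add x y hx hy => simp [hx, hy]

theorem isFlatML_iff_jointlyInjective {M : Type u} [AddCommGroup M] [Module R M] :
    IsFlatML R M ↔ ∀ (I X : Type u) [AddCommGroup X] [Module R X] (N : I → Type u)
      [∀ i, AddCommGroup (N i)] [∀ i, Module R (N i)] (φ : ∀ i, X →ₗ[R] N i),
      JointlyInjective φ → JointlyInjective fun i => (φ i).lTensor M := by
  refine ⟨fun ⟨_, hML⟩ I X _ _ N _ _ φ hφ t ht => ?_, fun h => ⟨?_, fun I N _ _ => ?_⟩⟩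
  · have hpi : Function.Injective (LinearMap.pi φ) :=
      (injective_iff_map_eq_zero _).2 fun x hx => hφ x fun i => congrFun hx i
    apply Module.Flat.lTensor_preserves_injective_linearMap (M := M) _ hpi
    rw [map_zero]
    apply hML
    ext i
    rw [piRightHom_apply, ← LinearMap.comp_apply, ← LinearMap.lTensor_comp, LinearMap.proj_pi, ht,
      map_zero, Pi.zero_apply]
  · exact Module.Flat.iff_lTensor_injective'.2 fun J => (injective_iff_map_eq_zero _).2 fun t ht =>
      h PUnit J (fun _ => R) (fun _ => J.subtype) (fun x hx => Subtype.ext (hx ⟨⟩)) t fun _ => ht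
  · exact (injective_iff_map_eq_zero _).2 fun t ht =>
      h I (∀ i, N i) N LinearMap.proj (fun x hx => funext hx) t fun i => by
        rw [← piRightHom_apply, ht, Pi.zero_apply]

theorem IsFlatML.of_isPureInjective (hB : IsFlatML R B) {f : A →ₗ[R] B} (hf : IsPureInjective f) :
    IsFlatML R A :=
  isFlatML_iff_jointlyInjective.2 fun I X _ _ N _ _ φ hφ =>
    (isFlatML_iff_jointlyInjective.1 hB I X N φ hφ).of_isPureInjective hf

theorem IsFlatML.of_equiv (hB : IsFlatML R B) (e : A ≃ₗ[R] B) : IsFlatML R A :=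
  hB.of_isPureInjective (isPureInjective_equiv e)

theorem IsFlatML.of_exact (hA : IsFlatML R A) (hQ : IsFlatML R Q) {f : A →ₗ[R] B} {g : B →ₗ[R] Q}
    (hf : Function.Injective f) (hfg : Function.Exact f g) (hg : Function.Surjective g) :
    IsFlatML R B :=
  isFlatML_iff_jointlyInjective.2 fun I X _ _ N _ _ φ hφ =>
    have := hQ.1
    (isFlatML_iff_jointlyInjective.1 hA I X N φ hφ).of_exact
      (isFlatML_iff_jointlyInjective.1 hQ I X N φ hφ) (isPureInjective_of_flat hf hfg hg) hfg hg

theorem isFlatML_of_subsingleton [Subsingleton A] : IsFlatML R A :=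
  ⟨inferInstance, fun _ _ _ _ => Function.injective_of_subsingleton _⟩

end FlatMittagLeffler

section DirectedUnion

variable {M X : Type u} [AddCommGroup M] [Module R M] [AddCommGroup X] [Module R X]

/-- The submodule `P` is contained in `Q` and is pure in it. -/
def IsPureLE (P Q : Submodule R M) : Prop :=
  ∃ h : P ≤ Q, IsPureInjective (Submodule.inclusion h)

theorem IsPureLE.refl (P : Submodule R M) : IsPureLE P P :=
  ⟨le_rfl, isPureInjective_of_comp_eq_id (g := LinearMap.id) rfl⟩

theorem IsPureLE.trans {P Q S : Submodule R M} (hPQ : IsPureLE P Q) (hQS : IsPureLE Q S) :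
    IsPureLE P S := by
  refine ⟨hPQ.1.trans hQS.1, ?_⟩
  have hcomp : Submodule.inclusion (hPQ.1.trans hQS.1) =
      Submodule.inclusion hQS.1 ∘ₗ Submodule.inclusion hPQ.1 := rfl
  exact hcomp ▸ hQS.2.comp hPQ.2

variable {ι : Type*} [Nonempty ι] {F : ι → Submodule R M}

theorem comap_iSup_of_directed (f : X →ₗ[R] M) (hF : Directed (· ≤ ·) F) :
    (⨆ i, F i).comap f = ⨆ i, (F i).comap f := by
  refine le_antisymm (fun x hx => ?_) (iSup_le fun i => Submodule.comap_mono (le_iSup F i))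
  obtain ⟨i, hi⟩ := (Submodule.mem_iSup_of_directed F hF).1 hx
  exact Submodule.mem_iSup_of_mem i hi

theorem exists_le_of_fg_of_directed (hF : Directed (· ≤ ·) F) {Q : Submodule R M} (hQ : Q.FG)
    (hle : Q ≤ ⨆ i, F i) : ∃ i, Q ≤ F i := by
  rw [Submodule.fg_iff_compact, CompleteLattice.isCompactElement_iff_le_of_directed_sSup_le] at hQ
  obtain ⟨_, ⟨i, rfl⟩, hi⟩ := hQ (Set.range F) (Set.range_nonempty F) (directedOn_range.2 hF) hle
  exact ⟨i, hi⟩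

theorem exists_rTensor_inclusion_eq (hF : Directed (· ≤ ·) F)
    (t : (⨆ i, F i : Submodule R M) ⊗[R] X) :
    ∃ i, ∃ s : F i ⊗[R] X, (Submodule.inclusion (le_iSup F i)).rTensor X s = t := by
  induction t with
  | zero => exact ⟨Classical.arbitrary ι, 0, map_zero _⟩
  | tmul p x =>
    obtain ⟨i, hi⟩ := (Submodule.mem_iSup_of_directed F hF).1 p.2
    exact ⟨i, (⟨p, hi⟩ : F i) ⊗ₜ x, rfl⟩
  | add t t' ht ht' =>
    obtain ⟨i, s, rfl⟩ := ht
    obtain ⟨j, s', rfl⟩ := ht'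
    obtain ⟨k, hik, hjk⟩ := hF i j
    refine ⟨k, (Submodule.inclusion hik).rTensor X s + (Submodule.inclusion hjk).rTensor X s', ?_⟩
    rw [map_add, ← LinearMap.rTensor_comp_apply, ← LinearMap.rTensor_comp_apply]
    rfl

theorem exists_rTensor_inclusion_eq_zero (hF : Directed (· ≤ ·) F) {i : ι} (t : F i ⊗[R] X)
    (ht : (Submodule.inclusion (le_iSup F i)).rTensor X t = 0) :
    ∃ j, ∀ k, F j ≤ F k → ∀ h : F i ≤ F k, (Submodule.inclusion h).rTensor X t = 0 := by
  obtain ⟨P, hP, s, rfl⟩ := TensorProduct.exists_of_fg t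
  let P' := P.map (Submodule.inclusion (le_iSup F i))
  have hs : P'.subtype.rTensor X
      (((Submodule.inclusion (le_iSup F i)).submoduleMap P).rTensor X s) = 0 := by
    rw [← ht, ← LinearMap.rTensor_comp_apply, ← LinearMap.rTensor_comp_apply]
    rfl
  obtain ⟨Q, hPQ, hQ, hsQ⟩ := TensorProduct.eq_zero_of_fg_of_subtype_eq_zero (hP.map _) hs
  obtain ⟨j, hj⟩ := exists_le_of_fg_of_directed hF (hQ.map _) (Submodule.map_subtype_le _ Q)
  refine ⟨j, fun k hjk hik => ?_⟩
  let q : Q →ₗ[R] F k := ((⨆ i, F i).subtype ∘ₗ Q.subtype).codRestrict (F k)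
    fun x => hjk (hj (Submodule.mem_map_of_mem x.2))
  have hq := congrArg (q.rTensor X) hsQ
  rw [map_zero, ← LinearMap.rTensor_comp_apply, ← LinearMap.rTensor_comp_apply] at hq
  rw [← hq, ← LinearMap.rTensor_comp_apply]
  rfl

theorem IsPureLE.le_iSup (hF : Directed IsPureLE F) (i : ι) : IsPureLE (F i) (⨆ i, F i) := by
  have hF' : Directed (· ≤ ·) F := hF.mono fun _ _ h => h.1
  refine ⟨_root_.le_iSup F i, fun N _ _ => (injective_iff_map_eq_zero _).2 fun t ht => ?_⟩
  obtain ⟨j, hj⟩ := exists_rTensor_inclusion_eq_zero hF' t ht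
  obtain ⟨k, ⟨hik, hpure⟩, hjk, -⟩ := hF i j
  exact hpure N (by rw [hj k hjk hik, map_zero])

theorem isPureInjective_subtype_iSup (hF : Directed (· ≤ ·) F)
    (hpure : ∀ i, IsPureInjective (F i).subtype) : IsPureInjective (⨆ i, F i).subtype := by
  refine fun N _ _ => (injective_iff_map_eq_zero _).2 fun t ht => ?_
  obtain ⟨i, s, rfl⟩ := exists_rTensor_inclusion_eq hF t
  rw [← LinearMap.rTensor_comp_apply, Submodule.subtype_comp_inclusion] at ht
  rw [(injective_iff_map_eq_zero _).1 (hpure i N) s ht, map_zero]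

theorem isFlatML_iSup (hF : Directed IsPureLE F) (hML : ∀ i, IsFlatML R (F i)) :
    IsFlatML R (⨆ i, F i : Submodule R M) := by
  refine isFlatML_iff_jointlyInjective.2 fun I X _ _ N _ _ φ hφ t ht => ?_
  obtain ⟨i, s, rfl⟩ := exists_rTensor_inclusion_eq (hF.mono fun _ _ h => h.1) t
  have hs : s = 0 := isFlatML_iff_jointlyInjective.1 (hML i) I X N φ hφ s fun j =>
    (IsPureLE.le_iSup hF i).2 (N j) (by rw [← lTensor_rTensor_comm, ht, map_zero])
  rw [hs, map_zero]

end DirectedUnion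

section ContinuousChain

variable {M : Type u} [AddCommGroup M] [Module R M]

/-- A continuous chain of submodules indexed by the ordinals `≤ σ` and starting at zero: the
filtrations of `filt` without the conditions on the union and the factors. -/
structure IsContinuousChain (σ : Ordinal.{u}) (F : Ordinal.{u} → Submodule R M) : Prop where
  mono : MonotoneOn F (Set.Iic σ)
  zero : F 0 = ⊥
  limit : ∀ β ≤ σ, Order.IsSuccLimit β → F β = ⨆ α : Set.Iio β, F α

theorem exact_inclusion_mkQ {P Q : Submodule R M} (h : P ≤ Q) :
    Function.Exact (Submodule.inclusion h) (P.submoduleOf Q).mkQ := by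
  rw [LinearMap.exact_iff, Submodule.ker_mkQ, Submodule.range_inclusion, Submodule.submoduleOf]

theorem isPureLE_of_isFlatML_quotient {P Q : Submodule R M} (h : P ≤ Q)
    (hQP : IsFlatML R (Q ⧸ P.submoduleOf Q)) : IsPureLE P Q :=
  have := hQP.1
  ⟨h, isPureInjective_of_flat (Submodule.inclusion_injective h) (exact_inclusion_mkQ h)
    (Submodule.mkQ_surjective _)⟩

namespace IsContinuousChain

variable {σ : Ordinal.{u}} {F : Ordinal.{u} → Submodule R M}

theorem le (h : IsContinuousChain σ F) {α β : Ordinal.{u}} (hαβ : α ≤ β) (hβ : β ≤ σ) :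
    F α ≤ F β :=
  h.mono (hαβ.trans hβ) hβ hαβ

theorem le_succ (h : IsContinuousChain σ F) {α : Ordinal.{u}} (hα : α < σ) :
    F α ≤ F (Order.succ α) :=
  h.le (Order.le_succ α) (Order.succ_le_of_lt hα)

theorem isPureLE_of_le (h : IsContinuousChain σ F)
    (hfac : ∀ α < σ, IsFlatML R (F (Order.succ α) ⧸ (F α).submoduleOf (F (Order.succ α))))
    {α β : Ordinal.{u}} (hαβ : α ≤ β) (hβ : β ≤ σ) : IsPureLE (F α) (F β) := by
  induction β using SuccOrder.limitRecOn generalizing α with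
  | isMin β hmin => rw [hαβ.antisymm (hmin hαβ)]; exact .refl _
  | succ β _ ih =>
    rcases Order.le_succ_iff_eq_or_le.1 hαβ with rfl | hαβ
    · exact .refl _
    have hβσ : β < σ := (Order.lt_succ β).trans_le hβ
    exact (ih hαβ hβσ.le).trans (isPureLE_of_isFlatML_quotient (h.le_succ hβσ) (hfac β hβσ))
  | isSuccLimit β hlim ih =>
    rcases hαβ.eq_or_lt with rfl | hαβ
    · exact .refl _
    have : Nonempty (Set.Iio β) := ⟨⟨α, hαβ⟩⟩
    have hdir : Directed IsPureLE fun α : Set.Iio β => F α :=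
      directed_of_isDirected_le fun γ δ hγδ => ih δ δ.2 hγδ (δ.2.le.trans hβ)
    rw [h.limit β hβ hlim]
    exact IsPureLE.le_iSup hdir ⟨α, hαβ⟩

theorem isFlatML_of_le (h : IsContinuousChain σ F)
    (hfac : ∀ α < σ, IsFlatML R (F (Order.succ α) ⧸ (F α).submoduleOf (F (Order.succ α))))
    {β : Ordinal.{u}} (hβ : β ≤ σ) : IsFlatML R (F β) := by
  induction β using SuccOrder.limitRecOn with
  | isMin β hmin =>
    obtain rfl : β = 0 := hmin.eq_bot
    rw [h.zero]
    exact isFlatML_of_subsingleton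
  | succ β _ ih =>
    have hβσ : β < σ := (Order.lt_succ β).trans_le hβ
    have hle := h.le_succ hβσ
    exact (ih hβσ.le).of_exact (hfac β hβσ) (Submodule.inclusion_injective hle)
      (exact_inclusion_mkQ hle) (Submodule.mkQ_surjective _)
  | isSuccLimit β hlim ih =>
    have : Nonempty (Set.Iio β) := ⟨⟨0, hlim.bot_lt⟩⟩
    rw [h.limit β hβ hlim]
    exact isFlatML_iSup (directed_of_isDirected_le fun γ δ hγδ =>
      h.isPureLE_of_le hfac hγδ (δ.2.le.trans hβ)) fun γ => ih γ γ.2 (γ.2.le.trans hβ)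

theorem isFlatML (h : IsContinuousChain σ F) (htop : F σ = ⊤)
    (hfac : ∀ α < σ, IsFlatML R (F (Order.succ α) ⧸ (F α).submoduleOf (F (Order.succ α)))) :
    IsFlatML R M :=
  (htop ▸ h.isFlatML_of_le hfac le_rfl).of_equiv Submodule.topEquiv.symm

end IsContinuousChain

end ContinuousChain

section StableFactorization

variable {P Q F : Type u} [AddCommGroup P] [Module R P] [AddCommGroup Q] [Module R Q]
  [AddCommGroup F] [Module R F]

theorem mem_range_rTensor_sInf (hQ : IsFlatML R Q) {K : Set (Submodule R P)} {t : P ⊗[R] Q}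
    (ht : ∀ p ∈ K, p.mkQ.rTensor Q t = 0) :
    t ∈ LinearMap.range ((sInf K).subtype.rTensor Q) := by
  refine (rTensor_exact Q (LinearMap.exact_subtype_mkQ _) (Submodule.mkQ_surjective _) t).1 ?_
  let φ : ∀ p : K, P ⧸ sInf K →ₗ[R] P ⧸ p.1 := fun p => Submodule.factor (sInf_le p.2)
  have hφ : JointlyInjective φ := by
    intro x hx
    obtain ⟨x, rfl⟩ := (sInf K).mkQ_surjective x
    refine (Submodule.Quotient.mk_eq_zero _).2 (Submodule.mem_sInf.2 fun p hp => ?_)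
    exact (Submodule.Quotient.mk_eq_zero p).1 (hx ⟨p, hp⟩)
  rw [← (TensorProduct.comm R _ Q).map_eq_zero_iff]
  refine isFlatML_iff_jointlyInjective.1 hQ K _ _ φ hφ _ fun p => ?_
  have hcomm : (φ p).lTensor Q (TensorProduct.comm R _ Q ((sInf K).mkQ.rTensor Q t)) =
      TensorProduct.comm R _ Q ((φ p).rTensor Q ((sInf K).mkQ.rTensor Q t)) := by
    rw [← LinearMap.comm_comp_rTensor_comp_comm_eq]
    simp
  rw [hcomm, ← LinearMap.rTensor_comp_apply, Submodule.factor_comp_mk, ht p p.2, map_zero]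

/-- The functionals on `P` that factor through every map `w : P → Rˡ` through which `x` factors. -/
def stableFunctionals (x : P →ₗ[R] Q) : Submodule R (Module.Dual R P) :=
  sInf {K | ∃ (l : ℕ) (w : P →ₗ[R] (Fin l →₀ R)) (z : (Fin l →₀ R) →ₗ[R] Q),
    z ∘ₗ w = x ∧ K = LinearMap.range w.dualMap}

theorem exists_sum_stableFunctionals (hQ : IsFlatML R Q) [Module.Finite R P]
    [Module.Projective R P] (x : P →ₗ[R] Q) :
    ∃ (m : ℕ) (k : Fin m → stableFunctionals x) (y : Fin m → Q),
      ∀ p, x p = ∑ j, (k j).1 p • y j := by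
  obtain ⟨t, rfl⟩ := dualTensorHom_bijective.surjective x
  have ht :
      t ∈ LinearMap.range ((stableFunctionals (dualTensorHom R P Q t)).subtype.rTensor Q) := by
    refine mem_range_rTensor_sInf hQ ?_
    rintro _ ⟨l, w, z, hzw, rfl⟩
    obtain ⟨s, rfl⟩ := dualTensorHom_bijective.surjective z
    have hst : w.dualMap.rTensor Q s = t := by
      apply dualTensorHom_bijective.injective
      rw [← hzw]
      exact LinearMap.congr_fun (dualTensorHom_comp_rTensor_dualMap w) s
    rw [← hst]
    exact (rTensor_exact Q (LinearMap.exact_map_mkQ_range _) (Submodule.mkQ_surjective _) _).2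
      ⟨s, rfl⟩
  obtain ⟨s, hs⟩ := ht
  obtain ⟨m, k, y, rfl⟩ := TensorProduct.exists_sum_tmul_eq s
  refine ⟨m, k, y, fun p => ?_⟩
  conv_lhs => rw [← hs]
  simp

theorem exists_stable_factorization (hQ : IsFlatML R Q) [Module.Finite R P]
    [Module.Projective R P] (x : P →ₗ[R] Q) :
    ∃ (m : ℕ) (v : P →ₗ[R] (Fin m →₀ R)) (y : (Fin m →₀ R) →ₗ[R] Q), y ∘ₗ v = x ∧
      ∀ (l : ℕ) (w : P →ₗ[R] (Fin l →₀ R)) (z : (Fin l →₀ R) →ₗ[R] Q), z ∘ₗ w = x →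
        ∃ g : (Fin l →₀ R) →ₗ[R] (Fin m →₀ R), v = g ∘ₗ w := by
  obtain ⟨m, k, y, hxy⟩ := exists_sum_stableFunctionals hQ x
  let e := (Finsupp.linearEquivFunOnFinite R R (Fin m)).symm
  refine ⟨m, e.toLinearMap ∘ₗ LinearMap.pi fun j => (k j).1, Finsupp.linearCombination R y, ?_,
    fun l w z hzw => ?_⟩
  · ext p
    simp [e, hxy, Finsupp.linearCombination_eq_fintype_linearCombination_apply,
      Fintype.linearCombination_apply]
  · have hk : ∀ j, ∃ f, w.dualMap f = (k j).1 := fun j =>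
      Submodule.mem_sInf.1 (k j).2 _ ⟨l, w, z, hzw, rfl⟩
    choose f hf using hk
    refine ⟨e.toLinearMap ∘ₗ LinearMap.pi f, ?_⟩
    simp only [← hf, LinearMap.comp_assoc]
    rfl

theorem exists_comp_eq_of_ker_le {f : P →ₗ[R] Q} {g : P →ₗ[R] F} (hf : Function.Surjective f)
    (h : LinearMap.ker f ≤ LinearMap.ker g) : ∃ g' : Q →ₗ[R] F, g' ∘ₗ f = g := by
  refine ⟨(LinearMap.ker f).liftQ g h ∘ₗ (f.quotKerEquivOfSurjective hf).symm.toLinearMap, ?_⟩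
  ext p
  have hp : f.quotKerEquivOfSurjective hf ((LinearMap.ker f).mkQ p) = f p := rfl
  rw [LinearMap.comp_apply, LinearMap.comp_apply, LinearEquiv.coe_coe, ← hp,
    LinearEquiv.symm_apply_apply, Submodule.mkQ_apply, Submodule.liftQ_apply]

/-- A factorization of the inclusion of `S` through a finite free module whose first map `toFree`
factors through that of every other such factorization. -/
structure StableFactorization (S : Submodule R Q) where
  rank : ℕ
  toFree : S →ₗ[R] (Fin rank →₀ R)
  ofFree : (Fin rank →₀ R) →ₗ[R] Q
  comp_eq : ofFree ∘ₗ toFree = S.subtype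
  exists_comp_eq : ∀ (l : ℕ) (w : S →ₗ[R] (Fin l →₀ R)) (z : (Fin l →₀ R) →ₗ[R] Q),
    z ∘ₗ w = S.subtype → ∃ g : (Fin l →₀ R) →ₗ[R] (Fin rank →₀ R), toFree = g ∘ₗ w

theorem IsFlatML.nonempty_stableFactorization (hQ : IsFlatML R Q) {S : Submodule R Q}
    (hS : S.FG) : Nonempty (StableFactorization S) := by
  have := hQ.1
  have : Module.Finite R S := Module.Finite.iff_fg.2 hS
  obtain ⟨n, x, hx⟩ := Module.Finite.exists_fin' R S
  obtain ⟨m, v, y, hyv, hv⟩ := exists_stable_factorization hQ (S.subtype ∘ₗ x)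
  have hker : LinearMap.ker x ≤ LinearMap.ker v := by
    intro p hp
    obtain ⟨l, w, z, hzw, hwp⟩ := Module.Flat.exists_factorization_of_apply_eq_zero_of_free
      (x := S.subtype ∘ₗ x) (f := p) (by rw [LinearMap.comp_apply, hp, map_zero])
    obtain ⟨g, rfl⟩ := hv l w z hzw.symm
    rw [LinearMap.mem_ker, LinearMap.comp_apply, hwp, map_zero]
  obtain ⟨toFree, rfl⟩ := exists_comp_eq_of_ker_le hx hker
  refine ⟨m, toFree, y, (LinearMap.cancel_right hx).1 hyv, fun l w z hzw => ?_⟩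
  obtain ⟨g, hg⟩ := hv l (w ∘ₗ x) z (by rw [← LinearMap.comp_assoc, hzw])
  exact ⟨g, (LinearMap.cancel_right hx).1 hg⟩

theorem IsFlatML.exists_lift_subtype (hQ : IsFlatML R Q) {S : Submodule R Q} (hS : S.FG)
    {π : F →ₗ[R] Q} (hπ : Function.Surjective π) : ∃ σ : S →ₗ[R] F, π ∘ₗ σ = S.subtype := by
  obtain ⟨s⟩ := hQ.nonempty_stableFactorization hS
  obtain ⟨t, ht⟩ := Module.projective_lifting_property π s.ofFree hπ
  exact ⟨t ∘ₗ s.toFree, by rw [← LinearMap.comp_assoc, ht, s.comp_eq]⟩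

end StableFactorization

section Presentation

variable {C Q Z : Type u} [AddCommGroup C] [Module R C] [AddCommGroup Q] [Module R Q]
  [AddCommGroup Z] [Module R Z] {κ : Cardinal.{u}}

theorem mk_iUnion_le_of_le (hκ : ℵ₀ ≤ κ) {ι α : Type u} {f : ι → Set α} (hι : #ι ≤ κ)
    (hf : ∀ i, #(f i) ≤ κ) : #(⋃ i, f i) ≤ κ :=
  (Cardinal.mk_iUnion_le f).trans (Cardinal.mul_le_of_le hκ hι (ciSup_le' hf))

theorem mk_finset_le (hκ : ℵ₀ ≤ κ) {α : Type u} (hα : #α ≤ κ) : #(Finset α) ≤ κ := by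
  cases finite_or_infinite α
  · exact (Cardinal.mk_lt_aleph0_iff.2 inferInstance).le.trans hκ
  · rwa [Cardinal.mk_finset_of_infinite]

theorem spanRank_iSup_le (hκ : ℵ₀ ≤ κ) {ι : Type u} (hι : #ι ≤ κ) {P : ι → Submodule R C}
    (hP : ∀ i, (P i).spanRank ≤ κ) : (⨆ i, P i).spanRank ≤ κ := by
  have hspan : ⨆ i, P i = Submodule.span R (⋃ i, (P i).generators) := by
    simp only [Submodule.span_iUnion, Submodule.span_generators]
  rw [hspan]
  exact (Submodule.spanRank_span_le_card _).trans
    (mk_iUnion_le_of_le hκ hι fun i => (Submodule.generators_card _).trans_le (hP i))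

theorem spanRank_sup_le (hκ : ℵ₀ ≤ κ) {P P' : Submodule R C} (hP : P.spanRank ≤ κ)
    (hP' : P'.spanRank ≤ κ) : (P ⊔ P').spanRank ≤ κ :=
  Submodule.spanRank_sup_le_sum_spanRank.trans (Cardinal.add_le_of_le hκ hP hP')

theorem exists_map_eq_of_spanRank_le {p : C →ₗ[R] Z} (hp : Function.Surjective p)
    {T : Submodule R Z} (hT : T.spanRank ≤ κ) :
    ∃ U : Submodule R C, U.map p = T ∧ U.spanRank ≤ κ := by
  refine ⟨Submodule.span R (Function.surjInv hp '' T.generators), ?_, ?_⟩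
  · rw [Submodule.map_span, ← Set.image_comp, (Function.rightInverse_surjInv hp).comp_eq_id,
      Set.image_id, Submodule.span_generators]
  · exact (Submodule.spanRank_span_le_card _).trans
      (Cardinal.mk_image_le.trans (T.generators_card.trans_le hT))

theorem spanRank_range_finsupp_le {X : Type u} (f : (X →₀ R) →ₗ[R] C) :
    (LinearMap.range f).spanRank ≤ #X := by
  rw [LinearMap.range_eq_map, ← (Finsupp.basisSingleOne (R := R) (ι := X)).span_eq,
    Submodule.map_span]
  exact (Submodule.spanRank_span_le_card _).trans (Cardinal.mk_image_le.trans Cardinal.mk_range_le)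

theorem IsLEPresented.spanRank_top_le (h : IsLEPresented R κ Q) :
    (⊤ : Submodule R Q).spanRank ≤ κ := by
  obtain ⟨I, J, f, g, hI, -, -, hg⟩ := h
  rw [← LinearMap.range_eq_top.2 hg]
  exact (spanRank_range_finsupp_le g).trans hI

theorem isLEPresented_of_spanRank_ker_le {X : Type u} (hX : #X ≤ κ) {π : (X →₀ R) →ₗ[R] Q}
    (hπ : Function.Surjective π) (hker : (LinearMap.ker π).spanRank ≤ κ) :
    IsLEPresented R κ Q := by
  obtain ⟨s, hs, hspan⟩ := (LinearMap.ker π).exists_span_set_card_eq_spanRank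
  refine ⟨X, s, Finsupp.linearCombination R (Subtype.val : s → X →₀ R), π, hX, hs.trans_le hker,
    ?_, hπ⟩
  rw [LinearMap.exact_iff, Finsupp.range_linearCombination, Subtype.range_coe, hspan]

theorem map_mem_span_range {s : Set C} (p : C →ₗ[R] Z) (y : s) :
    p y ∈ (Submodule.span R s).map p :=
  Submodule.mem_map_of_mem (Submodule.subset_span y.2)

theorem mem_span_range_sub_of_map_eq_zero (p : C →ₗ[R] Z) {s : Set C}
    (σ : (Submodule.span R s).map p →ₗ[R] C) {x : C} (hx : x ∈ Submodule.span R s)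
    (hpx : p x = 0) :
    x ∈ Submodule.span R (Set.range fun y : s => y.1 - σ ⟨p y, map_mem_span_range p y⟩) := by
  let d : Submodule.span R s →ₗ[R] C :=
    (Submodule.span R s).subtype - σ ∘ₗ p.submoduleMap (Submodule.span R s)
  have hd : d ⟨x, hx⟩ = x := by
    have hp : p.submoduleMap (Submodule.span R s) ⟨x, hx⟩ = 0 := Subtype.ext hpx
    simp [d, hp]
  have hmap : ∀ (x : C) (hx : x ∈ Submodule.span R s), d ⟨x, hx⟩ ∈
      Submodule.span R (Set.range fun y : s => y.1 - σ ⟨p y, map_mem_span_range p y⟩) := by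
    intro x hx
    induction hx using Submodule.span_induction with
    | mem x hx => exact Submodule.subset_span ⟨⟨x, hx⟩, rfl⟩
    | zero => exact (map_zero d).symm ▸ zero_mem _
    | add x y hx hy ihx ihy => exact (map_add d ⟨x, hx⟩ ⟨y, hy⟩).symm ▸ add_mem ihx ihy
    | smul r x hx ih => exact (map_smul d r ⟨x, hx⟩).symm ▸ Submodule.smul_mem _ r ih
  exact hd ▸ hmap x hx

theorem exists_cofinal_finsets (hκ : ℵ₀ ≤ κ) {D : Submodule R C} (hD : D.spanRank ≤ κ) :
    ∃ (ι : Type u) (s : ι → Finset C), #ι ≤ κ ∧ (∀ i, Submodule.span R (s i) ≤ D) ∧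
      ∀ S ≤ D, S.FG → ∃ i, S ≤ Submodule.span R (s i) := by
  classical
  refine ⟨Finset D.generators, fun s => s.image Subtype.val,
    mk_finset_le hκ (D.generators_card.trans_le hD), fun s => ?_, fun S hSD hS => ?_⟩
  · conv_rhs => rw [← D.span_generators]
    refine Submodule.span_mono fun x hx => ?_
    obtain ⟨y, -, rfl⟩ := Finset.mem_image.1 hx
    exact y.2
  · obtain ⟨T, rfl⟩ := hS
    rw [← D.span_generators] at hSD
    obtain ⟨s, hs, hle⟩ := Submodule.subset_span_finite_of_subset_span
      (Submodule.subset_span.trans hSD)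
    lift s to Finset D.generators using hs
    exact ⟨s, Submodule.span_le.2 hle⟩

theorem IsFlatML.exists_inf_ker_le (hQ : IsFlatML R Q) (hκ : ℵ₀ ≤ κ) {p : C →ₗ[R] Q}
    (hp : Function.Surjective p) {D : Submodule R C} (hD : D.spanRank ≤ κ) :
    ∃ W ≤ LinearMap.ker p, D ⊓ LinearMap.ker p ≤ W ∧ W.spanRank ≤ κ := by
  obtain ⟨ι, s, hι, -, hs⟩ := exists_cofinal_finsets hκ hD
  choose σ hσ using fun i =>
    hQ.exists_lift_subtype ((Submodule.fg_span (s i).finite_toSet).map p) hp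
  let rel : ι → Set C := fun i =>
    Set.range fun y : (s i : Set C) => y.1 - σ i ⟨p y, map_mem_span_range p y⟩
  refine ⟨Submodule.span R (⋃ i, rel i), ?_, fun x hx => ?_, ?_⟩
  · refine Submodule.span_le.2 (Set.iUnion_subset fun i => ?_)
    rintro _ ⟨y, rfl⟩
    have hy := LinearMap.congr_fun (hσ i) ⟨p y, map_mem_span_range p y⟩
    rw [LinearMap.comp_apply, Submodule.subtype_apply] at hy
    rw [SetLike.mem_coe, LinearMap.mem_ker, map_sub, hy, sub_self]
  · obtain ⟨i, hi⟩ := hs (R ∙ x) ((Submodule.span_singleton_le_iff_mem _ _).2 hx.1)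
      (Submodule.fg_span_singleton x)
    exact Submodule.span_mono (Set.subset_iUnion rel i) (mem_span_range_sub_of_map_eq_zero p (σ i)
      (hi (Submodule.mem_span_singleton_self x)) hx.2)
  · refine (Submodule.spanRank_span_le_card _).trans (mk_iUnion_le_of_le hκ hι fun i => ?_)
    exact Cardinal.mk_range_le.trans
      ((Cardinal.mk_lt_aleph0_iff.2 (s i).finite_toSet).le.trans hκ)

theorem IsFlatML.exists_comap_le (hQ : IsFlatML R Q) (hκ : ℵ₀ ≤ κ) {f : Z →ₗ[R] C} {g : C →ₗ[R] Q}
    (hf : Function.Injective f) (hfg : Function.Exact f g) (hg : Function.Surjective g)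
    {D : Submodule R C} (hD : D.spanRank ≤ κ) :
    ∃ T : Submodule R Z, D.comap f ≤ T ∧ T.spanRank ≤ κ := by
  obtain ⟨W, hWker, hW, hWκ⟩ := hQ.exists_inf_ker_le hκ hg hD
  rw [hfg.linearMap_ker_eq] at hWker hW
  refine ⟨W.comap f, fun x hx => hW ⟨hx, x, rfl⟩, ?_⟩
  rwa [← Submodule.spanRank_map_eq_of_injective _ hf, Submodule.map_comap_eq_of_le hWker]

theorem exists_surjective_finsupp_of_spanRank_le (hQ : (⊤ : Submodule R Q).spanRank ≤ κ) :
    ∃ (X : Type u) (π : (X →₀ R) →ₗ[R] Q), #X ≤ κ ∧ Function.Surjective π := by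
  obtain ⟨s, hs, hspan⟩ := (⊤ : Submodule R Q).exists_span_set_card_eq_spanRank
  refine ⟨s, Finsupp.linearCombination R Subtype.val, hs.trans_le hQ, ?_⟩
  rw [← LinearMap.range_eq_top, Finsupp.range_linearCombination, Subtype.range_coe, hspan]

theorem IsFlatML.isLEPresented (hQ : IsFlatML R Q) (hκ : ℵ₀ ≤ κ)
    (hgen : (⊤ : Submodule R Q).spanRank ≤ κ) : IsLEPresented R κ Q := by
  obtain ⟨X, π, hX, hπ⟩ := exists_surjective_finsupp_of_spanRank_le hgen
  have htop : (⊤ : Submodule R (X →₀ R)).spanRank ≤ κ := by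
    rw [← LinearMap.range_id]
    exact (spanRank_range_finsupp_le _).trans hX
  obtain ⟨W, hWle, hleW, hW⟩ := hQ.exists_inf_ker_le hκ hπ htop
  rw [top_inf_eq] at hleW
  exact isLEPresented_of_spanRank_ker_le hX hπ (hWle.antisymm hleW ▸ hW)

end Presentation

section CountablyGenerated

variable {Q F : Type u} [AddCommGroup Q] [Module R Q] [AddCommGroup F] [Module R F]

theorem exists_linearMap_extending {ι : Type*} {L : ι → Q →ₗ.[R] F}
    (hL : Directed (· ≤ ·) L) (htop : ⨆ i, (L i).domain = ⊤) :
    ∃ f : Q →ₗ[R] F, ∀ i (x : (L i).domain), f x = L i x := by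
  have hdom : (LinearPMap.sSup (Set.range L) hL.directedOn_range).domain = ⊤ := by
    rw [LinearPMap.domain_sSup, ← Set.range_comp, sSup_range]
    exact htop
  refine ⟨(LinearPMap.sSup (Set.range L) hL.directedOn_range).toFun ∘ₗ
    (LinearMap.id.codRestrict _ fun x => hdom ▸ Submodule.mem_top), fun i x => ?_⟩
  exact LinearPMap.sSup_apply hL.directedOn_range ⟨i, rfl⟩ x

theorem StableFactorization.le_range {S : Submodule R Q} (s : StableFactorization S) :
    S ≤ LinearMap.range s.ofFree := fun x hx =>
  ⟨s.toFree ⟨x, hx⟩, LinearMap.congr_fun s.comp_eq ⟨x, hx⟩⟩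

/-- Any lift of `ofFree` for the larger module can be corrected along the map provided by
stability of the smaller one. -/
theorem StableFactorization.exists_compatible_lift {S S' : Submodule R Q}
    (s : StableFactorization S) (s' : StableFactorization S')
    (h : LinearMap.range s.ofFree ≤ S') {π : F →ₗ[R] Q} (hπ : Function.Surjective π)
    {T : (Fin s.rank →₀ R) →ₗ[R] F} (hT : π ∘ₗ T = s.ofFree) :
    ∃ T' : (Fin s'.rank →₀ R) →ₗ[R] F, π ∘ₗ T' = s'.ofFree ∧
      T' ∘ₗ s'.toFree ∘ₗ Submodule.inclusion (s.le_range.trans h) = T ∘ₗ s.toFree := by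
  obtain ⟨t, ht⟩ := Module.projective_lifting_property π s'.ofFree hπ
  let w := s'.toFree ∘ₗ Submodule.inclusion (s.le_range.trans h)
  obtain ⟨g, hg⟩ := s.exists_comp_eq _ w s'.ofFree (by
    rw [← LinearMap.comp_assoc, s'.comp_eq, Submodule.subtype_comp_inclusion])
  let y : (Fin s.rank →₀ R) →ₗ[R] S' := s.ofFree.codRestrict S' fun a => h ⟨a, rfl⟩
  have hy : y ∘ₗ s.toFree = Submodule.inclusion (s.le_range.trans h) :=
    LinearMap.ext fun x => Subtype.ext (LinearMap.congr_fun s.comp_eq x)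
  have hπy : π ∘ₗ t ∘ₗ s'.toFree ∘ₗ y = s.ofFree := by
    rw [← LinearMap.comp_assoc, ht, ← LinearMap.comp_assoc, s'.comp_eq,
      LinearMap.subtype_comp_codRestrict]
  refine ⟨t + (T - t ∘ₗ s'.toFree ∘ₗ y) ∘ₗ g, ?_, ?_⟩
  · rw [LinearMap.comp_add, ← LinearMap.comp_assoc, LinearMap.comp_sub, hT, hπy, sub_self,
      LinearMap.zero_comp, add_zero, ht]
  · change (t + (T - t ∘ₗ s'.toFree ∘ₗ y) ∘ₗ g) ∘ₗ w = _
    rw [LinearMap.add_comp, LinearMap.comp_assoc, ← hg, LinearMap.sub_comp,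
      LinearMap.comp_assoc, LinearMap.comp_assoc, hy]
    abel

theorem IsFlatML.exists_stableFactorization_chain (hQ : IsFlatML R Q) (e : ℕ → Q) :
    ∃ (S : ℕ → Submodule R Q) (s : ∀ k, StableFactorization (S k)),
      ∀ k, LinearMap.range (s k).ofFree ≤ S (k + 1) ∧ e k ∈ S (k + 1) := by
  let s : ∀ S : {S : Submodule R Q // S.FG}, StableFactorization S.1 :=
    fun S => (hQ.nonempty_stableFactorization S.2).some
  let next : ℕ → {S : Submodule R Q // S.FG} → {S : Submodule R Q // S.FG} := fun k S =>
    ⟨LinearMap.range (s S).ofFree ⊔ Submodule.span R {e k},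
      (Module.Finite.iff_fg.1 inferInstance).sup (Submodule.fg_span_singleton _)⟩
  let S : ℕ → {S : Submodule R Q // S.FG} := Nat.rec ⟨⊥, Submodule.fg_bot⟩ next
  exact ⟨fun k => (S k).1, fun k => s (S k), fun k =>
    ⟨le_sup_left, Submodule.mem_sup_right (Submodule.mem_span_singleton_self _)⟩⟩

theorem IsFlatML.projective_of_span_range_eq_top (hQ : IsFlatML R Q) {e : ℕ → Q}
    (he : Submodule.span R (Set.range e) = ⊤) : Module.Projective R Q := by
  obtain ⟨S, s, hS⟩ := hQ.exists_stableFactorization_chain e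
  let π : (Q →₀ R) →ₗ[R] Q := Finsupp.linearCombination R id
  have hπ : Function.Surjective π := Finsupp.linearCombination_id_surjective R Q
  obtain ⟨t, ht⟩ := Module.projective_lifting_property π (s 0).ofFree hπ
  choose next hnext using fun k (T : {T // π ∘ₗ T = (s k).ofFree}) =>
    (s k).exists_compatible_lift (s (k + 1)) (hS k).1 hπ T.2
  let T : ∀ k, {T // π ∘ₗ T = (s k).ofFree} :=
    Nat.rec ⟨t, ht⟩ fun k T => ⟨next k T, (hnext k T).1⟩
  let L : ℕ → Q →ₗ.[R] (Q →₀ R) := fun k => ⟨S k, (T k).1 ∘ₗ (s k).toFree⟩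
  have hL : Monotone L := monotone_nat_of_le_succ fun k =>
    ⟨(s k).le_range.trans (hS k).1, fun x y hxy => by
      obtain rfl : Submodule.inclusion ((s k).le_range.trans (hS k).1) x = y := Subtype.ext hxy
      exact (LinearMap.congr_fun (hnext k (T k)).2 x).symm⟩
  have htop : ⨆ k, (L k).domain = ⊤ := by
    rw [eq_top_iff, ← he, Submodule.span_le]
    rintro _ ⟨k, rfl⟩
    exact le_iSup (fun k => (L k).domain) (k + 1) (hS k).2
  obtain ⟨σ, hσ⟩ := exists_linearMap_extending hL.directed_le htop
  refine Module.projective_def'.2 ⟨σ, LinearMap.ext fun q => ?_⟩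
  have hdom : Directed (· ≤ ·) fun k => (L k).domain :=
    hL.directed_le.mono_comp _ LinearPMap.domain_mono.monotone
  obtain ⟨k, hk⟩ := (Submodule.mem_iSup_of_directed _ hdom).1 (htop ▸ Submodule.mem_top (x := q))
  have hπT := LinearMap.congr_fun (T k).2 ((s k).toFree ⟨q, hk⟩)
  exact (congrArg π (hσ k ⟨q, hk⟩)).trans
    (hπT.trans (LinearMap.congr_fun (s k).comp_eq ⟨q, hk⟩))

theorem IsFlatML.projective_of_isLEPresented (hQ : IsFlatML R Q) (h : IsLEPresented R ℵ₀ Q) :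
    Module.Projective R Q := by
  obtain ⟨s, hs, hspan⟩ := (⊤ : Submodule R Q).exists_span_set_card_eq_spanRank
  have hs' : (insert 0 s).Countable :=
    (Cardinal.le_aleph0_iff_set_countable.1 (hs.trans_le h.spanRank_top_le)).insert 0
  obtain ⟨e, he⟩ := hs'.exists_eq_range (Set.insert_nonempty 0 s)
  exact hQ.projective_of_span_range_eq_top (by rw [← he, Submodule.span_insert_zero, hspan])

end CountablyGenerated

section IndexSets

variable {C : Type u} [AddCommGroup C] [Module R C] {σ : Ordinal.{u}}
  {F A : Ordinal.{u} → Submodule R C}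

/-- The isomorphism `Q / P ≃ π Q / π P` for a map `π` whose kernel meets `Q` inside `P`; it carries
the factors of a filtration over to an image of the filtration. -/
noncomputable def factorMapEquiv {C' : Type u} [AddCommGroup C'] [Module R C'] (π : C →ₗ[R] C')
    {P Q : Submodule R C} (hPQ : P ≤ Q) (h : LinearMap.ker π ⊓ Q ≤ P) :
    (Q ⧸ P.submoduleOf Q) ≃ₗ[R] (Q.map π ⧸ (P.map π).submoduleOf (Q.map π)) :=
  (Submodule.quotEquivOfEq _ _ (by
    ext x
    have hx : π x ∈ P.map π ↔ (x : C) ∈ P := by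
      rw [← Submodule.mem_comap, Submodule.comap_map_eq]
      refine ⟨fun hx => ?_, fun hx => Submodule.mem_sup_left hx⟩
      have hxQ : (x : C) ∈ (P ⊔ LinearMap.ker π) ⊓ Q := ⟨hx, x.2⟩
      rwa [sup_inf_assoc_of_le _ hPQ, sup_eq_left.2 h] at hxQ
    exact hx.symm.trans
      (Submodule.Quotient.mk_eq_zero ((P.map π).submoduleOf (Q.map π))
        (x := π.submoduleMap Q x)).symm)).trans
  ((((P.map π).submoduleOf (Q.map π)).mkQ ∘ₗ π.submoduleMap Q).quotKerEquivOfSurjective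
    ((Submodule.mkQ_surjective _).comp (π.submoduleMap_surjective Q)))

namespace IsContinuousChain

theorem biSup_le (h : IsContinuousChain σ F) (hA : ∀ α < σ, F α ⊔ A α = F (Order.succ α))
    {β : Ordinal.{u}} (hβ : β ≤ σ) : ⨆ γ ∈ Set.Iio β, A γ ≤ F β :=
  iSup₂_le fun γ hγ => (le_sup_right.trans_eq (hA γ (hγ.trans_le hβ))).trans
    (h.le (Order.succ_le_of_lt hγ) hβ)

theorem le_biSup (h : IsContinuousChain σ F) (hA : ∀ α < σ, F α ⊔ A α = F (Order.succ α))
    {β : Ordinal.{u}} (hβ : β ≤ σ) : F β ≤ ⨆ γ ∈ Set.Iio β, A γ := by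
  induction β using SuccOrder.limitRecOn with
  | isMin β hmin =>
    obtain rfl : β = 0 := hmin.eq_bot
    exact h.zero.trans_le bot_le
  | succ β _ ih =>
    have hβσ : β < σ := (Order.lt_succ β).trans_le hβ
    rw [← hA β hβσ]
    exact sup_le
      ((ih hβσ.le).trans (biSup_mono fun γ hγ => (Set.mem_Iio.1 hγ).trans (Order.lt_succ β)))
      (_root_.le_biSup A (Order.lt_succ β))
  | isSuccLimit β hlim ih =>
    rw [h.limit β hβ hlim]
    exact iSup_le fun α => (ih α.1 α.2 (α.2.le.trans hβ)).trans
      (biSup_mono fun γ hγ => (Set.mem_Iio.1 hγ).trans α.2)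

end IsContinuousChain

/-- A set `S` of indices is closed if the sum of the `A γ` with `γ ∈ S` meets each `F α` in the sum
of those with `γ < α`. The definition only asks for the intersections `F α ⊓ A α`, which suffices
by `IsClosedIndexSet.biSup_inf_le`. -/
def IsClosedIndexSet (F A : Ordinal.{u} → Submodule R C) (S : Set Ordinal.{u}) : Prop :=
  ∀ α ∈ S, F α ⊓ A α ≤ ⨆ γ ∈ S ∩ Set.Iio α, A γ

namespace IsClosedIndexSet

variable {S : Set Ordinal.{u}}

theorem sUnion {𝒮 : Set (Set Ordinal.{u})} (h : ∀ S ∈ 𝒮, IsClosedIndexSet F A S) :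
    IsClosedIndexSet F A (⋃₀ 𝒮) := fun α ⟨S, hS, hα⟩ =>
  (h S hS α hα).trans (biSup_mono fun _ hγ => ⟨⟨S, hS, hγ.1⟩, hγ.2⟩)

theorem biSup_succ_inf_le (hS : IsClosedIndexSet F A S) {β : Ordinal.{u}}
    (hβ : ⨆ γ ∈ S ∩ Set.Iio β, A γ ≤ F β) :
    (⨆ γ ∈ S ∩ Set.Iio (Order.succ β), A γ) ⊓ F β ≤ ⨆ γ ∈ S ∩ Set.Iio β, A γ := by
  by_cases hβS : β ∈ S
  · have hsplit : ⨆ γ ∈ S ∩ Set.Iio (Order.succ β), A γ ≤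
        (⨆ γ ∈ S ∩ Set.Iio β, A γ) ⊔ A β := iSup₂_le fun γ hγ => by
      rcases (Order.lt_succ_iff.1 (Set.mem_Iio.1 hγ.2)).lt_or_eq with h | rfl
      · exact le_sup_of_le_left (le_biSup A ⟨hγ.1, h⟩)
      · exact le_sup_right
    refine (inf_le_inf_right _ hsplit).trans ?_
    rw [sup_inf_assoc_of_le _ hβ, inf_comm]
    exact sup_le le_rfl (hS β hβS)
  · exact inf_le_left.trans (biSup_mono fun γ hγ => ⟨hγ.1,
      (Order.lt_succ_iff.1 (Set.mem_Iio.1 hγ.2)).lt_of_ne (ne_of_mem_of_not_mem hγ.1 hβS)⟩)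

theorem biSup_inf_le (hS : IsClosedIndexSet F A S) (h : IsContinuousChain σ F)
    (hA : ∀ α < σ, F α ⊔ A α = F (Order.succ α)) (α : Ordinal.{u}) {β : Ordinal.{u}}
    (hβ : β ≤ σ) : (⨆ γ ∈ S ∩ Set.Iio β, A γ) ⊓ F α ≤ ⨆ γ ∈ S ∩ Set.Iio α, A γ := by
  induction β using SuccOrder.limitRecOn with
  | isMin β hmin =>
    obtain rfl : β = 0 := hmin.eq_bot
    simp
  | succ β _ ih =>
    have hβσ : β < σ := (Order.lt_succ β).trans_le hβ
    rcases lt_or_ge β α with hlt | hle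
    · exact inf_le_left.trans (biSup_mono fun γ hγ =>
        ⟨hγ.1, (Order.lt_succ_iff.1 (Set.mem_Iio.1 hγ.2)).trans_lt hlt⟩)
    · have hle' := hS.biSup_succ_inf_le
        ((biSup_mono fun _ hγ => hγ.2).trans (h.biSup_le hA hβσ.le))
      exact (le_inf ((inf_le_inf_left _ (h.le hle hβσ.le)).trans hle') inf_le_right).trans
        (ih hβσ.le)
  | isSuccLimit β hlim ih =>
    let B : Set.Iio β → Submodule R C := fun δ => ⨆ γ ∈ S ∩ Set.Iio δ.1, A γ
    have hB : Monotone B := fun δ δ' hδ => biSup_mono fun γ hγ =>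
      ⟨hγ.1, (Set.mem_Iio.1 hγ.2).trans_le hδ⟩
    have hle : ⨆ γ ∈ S ∩ Set.Iio β, A γ ≤ ⨆ δ, B δ := iSup₂_le fun γ hγ =>
      le_iSup_of_le ⟨Order.succ γ, hlim.succ_lt hγ.2⟩ (le_biSup A ⟨hγ.1, Order.lt_succ γ⟩)
    refine (inf_le_inf_right _ hle).trans ?_
    rw [hB.directed_le.iSup_inf_eq]
    exact iSup_le fun δ => ih δ.1 δ.2 (δ.2.le.trans hβ)

theorem biSup_inf_succ_le (hS : IsClosedIndexSet F A S) (hSσ : S ⊆ Set.Iio σ)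
    (h : IsContinuousChain σ F) (hA : ∀ α < σ, F α ⊔ A α = F (Order.succ α)) {α : Ordinal.{u}}
    (hα : α < σ) (hαS : α ∉ S) : (⨆ γ ∈ S, A γ) ⊓ F (Order.succ α) ≤ F α := by
  have hle := hS.biSup_inf_le h hA (Order.succ α) le_rfl
  rw [Set.inter_eq_left.2 hSσ] at hle
  refine hle.trans ((biSup_mono fun γ hγ => ?_).trans (h.biSup_le hA hα.le))
  exact (Order.lt_succ_iff.1 (Set.mem_Iio.1 hγ.2)).lt_of_ne (ne_of_mem_of_not_mem hγ.1 hαS)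

theorem isFlatML_quotient (hS : IsClosedIndexSet F A S) (hSσ : S ⊆ Set.Iio σ)
    (h : IsContinuousChain σ F) (htop : F σ = ⊤) (hA : ∀ α < σ, F α ⊔ A α = F (Order.succ α))
    (hfac : ∀ α < σ, IsFlatML R (F (Order.succ α) ⧸ (F α).submoduleOf (F (Order.succ α)))) :
    IsFlatML R (C ⧸ ⨆ γ ∈ S, A γ) := by
  set N : Submodule R C := ⨆ γ ∈ S, A γ
  have hmap : IsContinuousChain σ fun α => (F α).map N.mkQ :=
    { mono := fun α hα β hβ hαβ => Submodule.map_mono (h.mono hα hβ hαβ)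
      zero := by rw [h.zero, Submodule.map_bot]
      limit := fun β hβ hlim => by rw [h.limit β hβ hlim, Submodule.map_iSup] }
  refine hmap.isFlatML (by rw [htop, Submodule.map_top, Submodule.range_mkQ]) fun α hα => ?_
  by_cases hαS : α ∈ S
  · have hbot : (A α).map N.mkQ = ⊥ := by
      rw [← le_bot_iff, Submodule.map_le_iff_le_comap, Submodule.comap_bot, Submodule.ker_mkQ]
      exact le_biSup A hαS
    rw [← hA α hα, Submodule.map_sup, hbot, sup_bot_eq, Submodule.submoduleOf_self]
    exact isFlatML_of_subsingleton
  · refine (hfac α hα).of_equiv (factorMapEquiv N.mkQ (h.le_succ hα) ?_).symm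
    rw [Submodule.ker_mkQ]
    exact hS.biSup_inf_succ_le hSσ h hA hα hαS

end IsClosedIndexSet

end IndexSets

section ProjectiveFactors

variable {M : Type u} [AddCommGroup M] [Module R M]

theorem exists_disjoint_sup_eq_of_projective {P Q : Submodule R M} (hPQ : P ≤ Q)
    [Module.Projective R (Q ⧸ P.submoduleOf Q)] :
    ∃ A : Submodule R M, Disjoint P A ∧ P ⊔ A = Q ∧ Module.Projective R A := by
  obtain ⟨s, hs⟩ := Module.projective_lifting_property (P.submoduleOf Q).mkQ LinearMap.id
    (P.submoduleOf Q).mkQ_surjective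
  have hinj : Function.Injective s := Function.LeftInverse.injective (LinearMap.congr_fun hs)
  have hidem : IsIdempotentElem (s ∘ₗ (P.submoduleOf Q).mkQ) := by
    change s ∘ₗ ((P.submoduleOf Q).mkQ ∘ₗ s) ∘ₗ (P.submoduleOf Q).mkQ = _
    rw [hs, LinearMap.id_comp]
  have hcompl := LinearMap.IsIdempotentElem.isCompl hidem
  rw [LinearMap.range_comp_of_range_eq_top _ (Submodule.range_mkQ _),
    LinearMap.ker_comp_of_ker_eq_bot _ (LinearMap.ker_eq_bot.2 hinj), Submodule.ker_mkQ] at hcompl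
  have hP : (P.submoduleOf Q).map Q.subtype = P := by
    rw [Submodule.submoduleOf, Submodule.map_comap_subtype, inf_eq_right.2 hPQ]
  have hdisj : Disjoint ((P.submoduleOf Q).map Q.subtype) ((LinearMap.range s).map Q.subtype) :=
    Submodule.disjoint_map Q.subtype_injective hcompl.disjoint.symm
  have hsup : (P.submoduleOf Q).map Q.subtype ⊔ (LinearMap.range s).map Q.subtype = Q := by
    rw [← Submodule.map_sup, sup_comm, hcompl.sup_eq_top, Submodule.map_subtype_top]
  rw [hP] at hdisj hsup
  exact ⟨_, hdisj, hsup, .of_equiv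
    ((LinearEquiv.ofInjective s hinj).trans (Submodule.equivSubtypeMap Q (LinearMap.range s)))⟩

theorem IsContinuousChain.projective {σ : Ordinal.{u}} {F : Ordinal.{u} → Submodule R M}
    (h : IsContinuousChain σ F) (htop : F σ = ⊤)
    (hfac : ∀ α < σ,
      Module.Projective R (F (Order.succ α) ⧸ (F α).submoduleOf (F (Order.succ α)))) :
    Module.Projective R M := by
  classical
  choose! A hA using fun α (hα : α < σ) =>
    have := hfac α hα
    exists_disjoint_sup_eq_of_projective (h.le_succ hα)
  have hsup : ∀ α < σ, F α ⊔ A α = F (Order.succ α) := fun α hα => (hA α hα).2.1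
  have hclosed : ∀ S ⊆ Set.Iio σ, IsClosedIndexSet F A S := fun S hS α hα =>
    (hA α (hS hα)).1.le_bot.trans bot_le
  have hind : iSupIndep fun α : Set.Iio σ => A α := fun α => by
    have hS := (hclosed (Set.Iio σ \ {α.1}) Set.sdiff_subset).biSup_inf_succ_le Set.sdiff_subset h
      hsup α.2 fun hα => hα.2 rfl
    refine disjoint_iff_inf_le.2 ((le_inf ?_ inf_le_left).trans (hA α α.2).1.le_bot)
    refine le_trans (le_inf (inf_le_right.trans ?_) (inf_le_left.trans ?_)) hS
    · exact iSup₂_le fun γ hγ =>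
        _root_.le_biSup A ⟨γ.2, fun h => hγ (Subtype.ext h)⟩
    · exact le_sup_right.trans_eq (hsup α α.2)
  have hspan : ⨆ α : Set.Iio σ, A α = ⊤ := by
    rw [eq_top_iff, ← htop, iSup_subtype]
    exact h.le_biSup hsup le_rfl
  have hint := DirectSum.isInternal_submodule_of_iSupIndep_of_iSup_eq_top hind hspan
  have (α : Set.Iio σ) : Module.Projective R (A α) := (hA α α.2).2.2
  exact Module.Projective.of_equiv (LinearEquiv.ofBijective (DirectSum.coeLinearMap _) hint)

end ProjectiveFactors

section HillFamilies

variable {C : Type u} [AddCommGroup C] [Module R C] {κ : Cardinal.{u}}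

/-- A Hill family for `κ`: a set of submodules which is closed under sums, contains a
`≤ κ`-generated submodule around every element, and whose members have flat Mittag-Leffler
quotients. It is what remains of a filtration once its ordering is forgotten. -/
structure IsHillFamily (κ : Cardinal.{u}) (H : Set (Submodule R C)) : Prop where
  sSup_mem : ∀ 𝒮 ⊆ H, sSup 𝒮 ∈ H
  exists_mem : ∀ x, ∃ P ∈ H, x ∈ P ∧ P.spanRank ≤ κ
  isFlatML_quotient : ∀ P ∈ H, IsFlatML R (C ⧸ P)

theorem IsLEPresented.of_equiv {Q N : Type u} [AddCommGroup Q] [Module R Q] [AddCommGroup N]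
    [Module R N] (h : IsLEPresented R κ N) (e : Q ≃ₗ[R] N) : IsLEPresented R κ Q := by
  obtain ⟨I, J, f, g, hI, hJ, hfg, hg⟩ := h
  refine ⟨I, J, f, e.symm.toLinearMap ∘ₗ g, hI, hJ, ?_, e.symm.surjective.comp hg⟩
  exact hfg.comp_injective _ e.symm.injective e.symm.map_zero

theorem exists_sup_eq_of_isLEPresented {P Q : Submodule R C} (hPQ : P ≤ Q)
    (hQP : IsLEPresented R κ (Q ⧸ P.submoduleOf Q)) :
    ∃ A : Submodule R C, P ⊔ A = Q ∧ A.spanRank ≤ κ ∧ (P ⊓ A).spanRank ≤ κ := by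
  obtain ⟨I, J, f, g, hI, hJ, hfg, hg⟩ := hQP
  obtain ⟨h, rfl⟩ := Module.projective_lifting_property (P.submoduleOf Q).mkQ g
    (P.submoduleOf Q).mkQ_surjective
  have hmem (x : I →₀ R) : (P.submoduleOf Q).mkQ (h x) = 0 ↔ (h x : C) ∈ P :=
    Submodule.Quotient.mk_eq_zero _
  refine ⟨LinearMap.range (Q.subtype ∘ₗ h), le_antisymm (sup_le hPQ ?_) fun q hq => ?_,
    (spanRank_range_finsupp_le _).trans hI, ?_⟩
  · rintro _ ⟨x, rfl⟩
    exact (h x).2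
  · obtain ⟨x, hx⟩ := hg ((P.submoduleOf Q).mkQ ⟨q, hq⟩)
    have hsub : q - h x ∈ P := (Submodule.Quotient.eq (P.submoduleOf Q)).1 hx.symm
    exact Submodule.mem_sup.2 ⟨_, hsub, _, ⟨x, rfl⟩, sub_add_cancel _ _⟩
  · have hrel : P ⊓ LinearMap.range (Q.subtype ∘ₗ h) = LinearMap.range (Q.subtype ∘ₗ h ∘ₗ f) := by
      ext c
      constructor
      · rintro ⟨hP, x, rfl⟩
        obtain ⟨z, rfl⟩ := (hfg x).1 ((hmem x).2 hP)
        exact ⟨z, rfl⟩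
      · rintro ⟨z, rfl⟩
        exact ⟨(hmem _).1 (hfg.apply_apply_eq_zero z), f z, rfl⟩
    rw [hrel]
    exact (spanRank_range_finsupp_le _).trans hJ

section ClosedIndexSets

variable {σ : Ordinal.{u}} {F A : Ordinal.{u} → Submodule R C}

theorem IsClosedIndexSet.insert {S : Set Ordinal.{u}} (hS : IsClosedIndexSet F A S)
    {β : Ordinal.{u}} (hSβ : S ⊆ Set.Iio β) (hle : F β ⊓ A β ≤ ⨆ γ ∈ S, A γ) :
    IsClosedIndexSet F A (insert β S) := by
  rintro α (rfl | hα)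
  · exact hle.trans (biSup_mono fun γ hγ => ⟨Set.mem_insert_of_mem _ hγ, hSβ hγ⟩)
  · exact (hS α hα).trans (biSup_mono fun γ hγ => ⟨Set.mem_insert_of_mem _ hγ.1, hγ.2⟩)

theorem exists_isClosedIndexSet_of_forall_mem (hκ : ℵ₀ ≤ κ) {T : Set Ordinal.{u}}
    {P : Submodule R C} (hP : P.spanRank ≤ κ)
    (h : ∀ x ∈ P, ∃ S ⊆ T, IsClosedIndexSet F A S ∧ x ∈ ⨆ γ ∈ S, A γ ∧
      (⨆ γ ∈ S, A γ).spanRank ≤ κ) :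
    ∃ S ⊆ T, IsClosedIndexSet F A S ∧ P ≤ ⨆ γ ∈ S, A γ ∧ (⨆ γ ∈ S, A γ).spanRank ≤ κ := by
  choose! S hST hS hxS hSκ using h
  have hgen : P.generators ⊆ P := Submodule.subset_span.trans_eq (by rw [P.span_generators])
  have hsup : ⨆ γ ∈ ⋃ x : P.generators, S x, A γ = ⨆ x : P.generators, ⨆ γ ∈ S x, A γ :=
    iSup_iUnion _ _
  refine ⟨⋃ x : P.generators, S x, Set.iUnion_subset fun x => hST x (hgen x.2), ?_, ?_, ?_⟩
  · rw [← Set.sUnion_range]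
    exact .sUnion (Set.forall_mem_range.2 fun x => hS x (hgen x.2))
  · rw [hsup]
    conv_lhs => rw [← P.span_generators]
    exact Submodule.span_le.2 fun x hx =>
      Submodule.mem_iSup_of_mem (⟨x, hx⟩ : P.generators) (hxS x (hgen hx))
  · rw [hsup]
    exact spanRank_iSup_le hκ (P.generators_card.trans_le hP) fun x => hSκ x (hgen x.2)

theorem IsContinuousChain.exists_isClosedIndexSet (h : IsContinuousChain σ F) (hκ : ℵ₀ ≤ κ)
    (hA : ∀ α < σ, F α ⊔ A α = F (Order.succ α)) (hgen : ∀ α < σ, (A α).spanRank ≤ κ)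
    (hrel : ∀ α < σ, (F α ⊓ A α).spanRank ≤ κ) {β : Ordinal.{u}} (hβ : β ≤ σ) {x : C}
    (hx : x ∈ F β) :
    ∃ S ⊆ Set.Iio β, IsClosedIndexSet F A S ∧ x ∈ ⨆ γ ∈ S, A γ ∧
      (⨆ γ ∈ S, A γ).spanRank ≤ κ := by
  induction β using SuccOrder.limitRecOn generalizing x with
  | isMin β hmin =>
    obtain rfl : β = 0 := hmin.eq_bot
    rw [h.zero, Submodule.mem_bot] at hx
    exact ⟨∅, Set.empty_subset _, fun α hα => hα.elim, hx ▸ zero_mem _, by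
      rw [iSup_emptyset, Submodule.spanRank_eq_zero_iff_eq_bot.2 rfl]; exact zero_le⟩
  | succ β _ ih =>
    have hβσ : β < σ := (Order.lt_succ β).trans_le hβ
    rw [← hA β hβσ] at hx
    obtain ⟨y, hy, a, ha, rfl⟩ := Submodule.mem_sup.1 hx
    have hspan : (R ∙ y).spanRank ≤ κ :=
      (Submodule.spanRank_span_le_card _).trans ((Cardinal.mk_singleton y).trans_le
        (Cardinal.one_le_aleph0.trans hκ))
    obtain ⟨S, hSβ, hS, hle, hSκ⟩ := exists_isClosedIndexSet_of_forall_mem hκ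
      (spanRank_sup_le hκ hspan (hrel β hβσ)) fun z hz => ih hβσ.le
        (sup_le ((Submodule.span_singleton_le_iff_mem _ _).2 hy) inf_le_left hz)
    refine ⟨insert β S, Set.insert_subset (Order.lt_succ β) (hSβ.trans fun γ hγ =>
      (Set.mem_Iio.1 hγ).trans (Order.lt_succ β)), hS.insert hSβ (le_sup_right.trans hle), ?_, ?_⟩
    · rw [iSup_insert, sup_comm]
      exact Submodule.add_mem_sup
        (hle (Submodule.mem_sup_left (Submodule.mem_span_singleton_self y))) ha
    · rw [iSup_insert]
      exact spanRank_sup_le hκ (hgen β hβσ) hSκ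
  | isSuccLimit β hlim ih =>
    have : Nonempty (Set.Iio β) := ⟨⟨0, hlim.bot_lt⟩⟩
    have hdir : Directed (· ≤ ·) fun α : Set.Iio β => F α :=
      Monotone.directed_le fun α α' hα => h.le hα (α'.2.le.trans hβ)
    rw [h.limit β hβ hlim, Submodule.mem_iSup_of_directed _ hdir] at hx
    obtain ⟨α, hα⟩ := hx
    obtain ⟨S, hSα, hS⟩ := ih α.1 α.2 (α.2.le.trans hβ) hα
    exact ⟨S, hSα.trans (Set.Iio_subset_Iio α.2.le), hS⟩

end ClosedIndexSets

theorem exists_isHillFamily (hκ : ℵ₀ ≤ κ) {C : ModuleCat.{u} R} (hC : restrictedFlatML R κ C) :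
    ∃ H : Set (Submodule R C), IsHillFamily κ H := by
  obtain ⟨σ, F, hmono, hzero, htop, hlim, hfac⟩ := hC
  have h : IsContinuousChain σ F := ⟨hmono, hzero, hlim⟩
  choose! N hN e using hfac
  choose! A hA hgen hrel using fun α (hα : α < σ) =>
    exists_sup_eq_of_isLEPresented (h.le_succ hα) ((hN α hα).1.of_equiv (e α hα).some)
  let closed : Set (Set Ordinal.{u}) := {S | S ⊆ Set.Iio σ ∧ IsClosedIndexSet F A S}
  refine ⟨(fun S => ⨆ γ ∈ S, A γ) '' closed, ⟨fun 𝒮 h𝒮 => ?_, fun x => ?_, ?_⟩⟩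
  · obtain ⟨𝒯, h𝒯, rfl⟩ := Set.subset_image_iff.1 h𝒮
    refine ⟨⋃₀ 𝒯, ⟨Set.sUnion_subset fun S hS => (h𝒯 hS).1, .sUnion fun S hS => (h𝒯 hS).2⟩, ?_⟩
    dsimp only
    rw [sSup_image, Set.sUnion_eq_iUnion, iSup_iUnion, iSup_subtype]
  · obtain ⟨S, hSσ, hS, hx, hSκ⟩ := h.exists_isClosedIndexSet hκ hA hgen hrel le_rfl
      (htop ▸ Submodule.mem_top : x ∈ F σ)
    exact ⟨_, ⟨S, ⟨hSσ, hS⟩, rfl⟩, hx, hSκ⟩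
  · rintro _ ⟨S, ⟨hSσ, hS⟩, rfl⟩
    exact hS.isFlatML_quotient hSσ h htop hA fun α hα =>
      IsFlatML.of_equiv (hN α hα).2 (e α hα).some

theorem isFlatML_finsupp {ι : Type u} : IsFlatML R (ι →₀ R) := by
  classical
  refine isFlatML_iff_jointlyInjective.2 fun I X _ _ N _ _ φ hφ t ht => ?_
  have hcoord (j : I) (i : ι) (t : (ι →₀ R) ⊗[R] X) :
      TensorProduct.finsuppScalarLeft R (N j) ι ((φ j).lTensor (ι →₀ R) t) i =
        φ j (TensorProduct.finsuppScalarLeft R X ι t i) := by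
    induction t with
    | zero => simp
    | tmul f x => simp [TensorProduct.finsuppScalarLeft_apply_tmul_apply]
    | add s t hs ht => simp only [map_add, Finsupp.add_apply, hs, ht]
  rw [← LinearEquiv.map_eq_zero_iff (TensorProduct.finsuppScalarLeft R X ι)]
  ext i
  exact hφ _ fun j => by rw [← hcoord, ht, map_zero, Finsupp.zero_apply]

theorem isHillFamily_supported (hκ : ℵ₀ ≤ κ) {ι : Type u} :
    IsHillFamily κ (Set.range fun S : Set ι => Finsupp.supported R R S) where
  sSup_mem 𝒮 h𝒮 := by
    rw [← Set.image_univ] at h𝒮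
    obtain ⟨𝒯, -, rfl⟩ := Set.subset_image_iff.1 h𝒮
    refine ⟨⋃₀ 𝒯, ?_⟩
    dsimp only
    rw [sSup_image, Set.sUnion_eq_iUnion, Finsupp.supported_iUnion, iSup_subtype]
  exists_mem x := by
    refine ⟨_, ⟨x.support, rfl⟩, (Finsupp.mem_supported R x).2 subset_rfl, ?_⟩
    dsimp only
    rw [Finsupp.supported_eq_span_single]
    exact (Submodule.spanRank_finite_iff_fg.2
      (Submodule.fg_span (x.support.finite_toSet.image _))).le.trans hκ
  isFlatML_quotient := by
    rintro _ ⟨S, rfl⟩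
    have hcompl : IsCompl (Finsupp.supported R R S) (Finsupp.supported R R Sᶜ) :=
      ⟨Finsupp.disjoint_supported_supported disjoint_compl_right,
        Finsupp.codisjoint_supported_supported (isCompl_compl (x := S)).codisjoint⟩
    exact isFlatML_finsupp.of_equiv ((Submodule.quotientEquivOfIsCompl _ _ hcompl).trans
      (Finsupp.supportedEquivFinsupp Sᶜ))

namespace IsHillFamily

variable {H : Set (Submodule R C)}

theorem bot_mem (hH : IsHillFamily κ H) : ⊥ ∈ H :=
  sSup_empty (α := Submodule R C) ▸ hH.sSup_mem ∅ (Set.empty_subset H)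

theorem sup_mem (hH : IsHillFamily κ H) {P Q : Submodule R C} (hP : P ∈ H) (hQ : Q ∈ H) :
    P ⊔ Q ∈ H :=
  sSup_pair (a := P) (b := Q) ▸ hH.sSup_mem _ (Set.pair_subset hP hQ)

theorem isFlatML (hH : IsHillFamily κ H) : IsFlatML R C :=
  (hH.isFlatML_quotient ⊥ hH.bot_mem).of_equiv (Submodule.quotEquivOfEqBot ⊥ rfl).symm

theorem exists_ge (hH : IsHillFamily κ H) (hκ : ℵ₀ ≤ κ) {D : Submodule R C}
    (hD : D.spanRank ≤ κ) : ∃ P ∈ H, D ≤ P ∧ P.spanRank ≤ κ := by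
  choose P hP hxP hPκ using hH.exists_mem
  refine ⟨⨆ x : D.generators, P x, hH.sSup_mem _ (Set.range_subset_iff.2 fun x => hP x), ?_,
    spanRank_iSup_le hκ (D.generators_card.trans_le hD) fun x => hPκ x⟩
  conv_lhs => rw [← D.span_generators]
  exact Submodule.span_le.2 fun x hx =>
    Submodule.mem_iSup_of_mem (⟨x, hx⟩ : D.generators) (hxP x)

theorem quotient (hH : IsHillFamily κ H) {D : Submodule R C} (hD : D ∈ H) :
    IsHillFamily κ (Submodule.map D.mkQ '' H) where
  sSup_mem 𝒮 h𝒮 := by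
    obtain ⟨𝒯, h𝒯, rfl⟩ := Set.subset_image_iff.1 h𝒮
    refine ⟨sSup 𝒯, hH.sSup_mem 𝒯 h𝒯, ?_⟩
    rw [sSup_image, sSup_eq_iSup]
    simp only [Submodule.map_iSup]
  exists_mem x := by
    obtain ⟨c, rfl⟩ := D.mkQ_surjective x
    obtain ⟨P, hP, hc, hPκ⟩ := hH.exists_mem c
    exact ⟨_, ⟨P, hP, rfl⟩, Submodule.mem_map_of_mem hc, (Submodule.spanRank_map_le _ _).trans hPκ⟩
  isFlatML_quotient := by
    rintro _ ⟨P, hP, rfl⟩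
    exact (hH.isFlatML_quotient _ (hH.sup_mem hD hP)).of_equiv
      (Submodule.quotientQuotientEquivQuotientSup D P)

end IsHillFamily

end HillFamilies

section RelativePurity

variable {M X : Type u} [AddCommGroup M] [Module R M] [AddCommGroup X] [Module R X]
  {κ : Cardinal.{u}}

theorem StableFactorization.rTensor_toFree_eq_zero {S : Submodule R M} (f : StableFactorization S)
    (hM : IsFlatML R M) (hS : S.FG) {t : S ⊗[R] X} (ht : S.subtype.rTensor X t = 0) :
    f.toFree.rTensor X t = 0 := by
  obtain ⟨S', hle, hS', ht'⟩ := TensorProduct.eq_zero_of_fg_of_subtype_eq_zero hS ht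
  obtain ⟨f'⟩ := hM.nonempty_stableFactorization hS'
  obtain ⟨g, hg⟩ := f.exists_comp_eq f'.rank (f'.toFree ∘ₗ Submodule.inclusion hle) f'.ofFree (by
    rw [← LinearMap.comp_assoc, f'.comp_eq, Submodule.subtype_comp_inclusion])
  rw [hg, LinearMap.rTensor_comp_apply, LinearMap.rTensor_comp_apply, ht', map_zero, map_zero]

/-- Purity of `P ≤ P'` relative to the ambient module `M`: an element of `P ⊗ N` which vanishes in
`M ⊗ N` already vanishes in `P' ⊗ N`. -/
def IsPureWithin (P P' : Submodule R M) : Prop :=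
  ∃ h : P ≤ P', ∀ (N : Type u) [AddCommGroup N] [Module R N] (t : P ⊗[R] N),
    P.subtype.rTensor N t = 0 → (Submodule.inclusion h).rTensor N t = 0

theorem IsPureWithin.mono {P P' Q Q' : Submodule R M} (h : IsPureWithin P P') (hP : Q ≤ P)
    (hP' : P' ≤ Q') : IsPureWithin Q Q' := by
  refine ⟨hP.trans (h.1.trans hP'), fun N _ _ t ht => ?_⟩
  have hzero := h.2 N ((Submodule.inclusion hP).rTensor N t) (by
    rwa [← LinearMap.rTensor_comp_apply, Submodule.subtype_comp_inclusion])
  have hzero' := congrArg ((Submodule.inclusion hP').rTensor N) hzero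
  rwa [map_zero, ← LinearMap.rTensor_comp_apply, ← LinearMap.rTensor_comp_apply] at hzero'

theorem isPureInjective_subtype_iSup_of_isPureWithin {P : ℕ → Submodule R M}
    (hP : ∀ k, IsPureWithin (P k) (P (k + 1))) : IsPureInjective (⨆ k, P k).subtype := by
  refine fun N _ _ => (injective_iff_map_eq_zero _).2 fun t ht => ?_
  obtain ⟨k, s, rfl⟩ := exists_rTensor_inclusion_eq
    (monotone_nat_of_le_succ fun k => (hP k).1).directed_le t
  rw [← LinearMap.rTensor_comp_apply, Submodule.subtype_comp_inclusion] at ht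
  have hs := congrArg ((Submodule.inclusion (le_iSup P (k + 1))).rTensor N) ((hP k).2 N s ht)
  rwa [map_zero, ← LinearMap.rTensor_comp_apply] at hs

theorem IsFlatML.exists_isPureWithin (hM : IsFlatML R M) (hκ : ℵ₀ ≤ κ) {P : Submodule R M}
    (hP : P.spanRank ≤ κ) : ∃ P' : Submodule R M, P'.spanRank ≤ κ ∧ IsPureWithin P P' := by
  obtain ⟨ι, s, hι, _, hs⟩ := exists_cofinal_finsets hκ hP
  have hfg (i : ι) : (Submodule.span R (s i : Set M)).FG := Submodule.fg_span (s i).finite_toSet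
  let f (i : ι) := (hM.nonempty_stableFactorization (hfg i)).some
  let P' := P ⊔ ⨆ i, LinearMap.range (f i).ofFree
  have hrange (i : ι) : LinearMap.range (f i).ofFree ≤ P' :=
    (le_iSup (fun i => LinearMap.range (f i).ofFree) i).trans le_sup_right
  refine ⟨P', spanRank_sup_le hκ hP (spanRank_iSup_le hκ hι fun i => ?_), le_sup_left,
    fun N _ _ t ht => ?_⟩
  · exact (Submodule.spanRank_finite_iff_fg.2
      (Module.Finite.iff_fg.1 (Module.Finite.range _))).le.trans hκ
  · obtain ⟨S, hS, hSP, t, rfl⟩ := Submodule.exists_fg_le_eq_rTensor_inclusion t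
    obtain ⟨i, hi⟩ := hs S hSP hS
    have hincl : Submodule.inclusion (hSP.trans le_sup_left : S ≤ P') =
        (f i).ofFree.codRestrict P' (fun x => hrange i ⟨x, rfl⟩) ∘ₗ (f i).toFree ∘ₗ
          Submodule.inclusion hi :=
      LinearMap.ext fun x => Subtype.ext
        (LinearMap.congr_fun (f i).comp_eq (Submodule.inclusion hi x)).symm
    rw [← LinearMap.rTensor_comp_apply, Submodule.subtype_comp_inclusion,
      ← Submodule.subtype_comp_inclusion _ _ hi, LinearMap.rTensor_comp_apply] at ht
    rw [← LinearMap.rTensor_comp_apply]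
    change (Submodule.inclusion (hSP.trans le_sup_left : S ≤ P')).rTensor N t = 0
    rw [hincl, LinearMap.rTensor_comp_apply, LinearMap.rTensor_comp_apply,
      (f i).rTensor_toFree_eq_zero hM (hfg i) ht, map_zero]

end RelativePurity

section Spliced

variable {Z C : ℤ → Type u} [∀ n, AddCommGroup (Z n)] [∀ n, Module R (Z n)]
  [∀ n, AddCommGroup (C n)] [∀ n, Module R (C n)]
  {i : ∀ n, Z n →ₗ[R] C n} {p : ∀ n, C (n + 1) →ₗ[R] Z n}
  {κ : Cardinal.{u}} {H : ∀ n, Set (Submodule R (C n))}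

/-- Short exact sequences `0 → Z (n + 1) → C (n + 1) → Z n → 0`, into which an acyclic complex with
components `C n` and cycles `Z n` decomposes. -/
structure IsSpliced (i : ∀ n, Z n →ₗ[R] C n) (p : ∀ n, C (n + 1) →ₗ[R] Z n) : Prop where
  injective : ∀ n, Function.Injective (i n)
  surjective : ∀ n, Function.Surjective (p n)
  exact : ∀ n, Function.Exact (i (n + 1)) (p n)

theorem forall_int_of_forall_add_one {P : ℤ → Prop} (h : ∀ n, P (n + 1)) (n : ℤ) : P n :=
  sub_add_cancel n 1 ▸ h (n - 1)

theorem exists_forall_add_one_eq {X : ℤ → Type*} (f : ∀ n, X (n + 1)) :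
    ∃ g : ∀ n, X n, ∀ n, g (n + 1) = f n :=
  ⟨Equiv.piCongrLeft X (Equiv.addRight (1 : ℤ)) f,
    Equiv.piCongrLeft_apply_apply X (Equiv.addRight (1 : ℤ)) f⟩

theorem IsSpliced.isFlatML (h : IsSpliced i p) (hZ : ∀ n, Module.Flat R (Z n))
    (hC : ∀ n, IsFlatML R (C n)) : ∀ n, IsFlatML R (Z n) :=
  forall_int_of_forall_add_one fun n =>
    have := hZ n
    (hC (n + 1)).of_isPureInjective
      (isPureInjective_of_flat (h.injective _) (h.exact n) (h.surjective n))

/-- One step in the closure process which makes a family `D` of small submodules of the components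
exact and its cycles pure; the union of an infinite sequence of such steps is closed. -/
structure IsEnlargement (i : ∀ n, Z n →ₗ[R] C n) (p : ∀ n, C (n + 1) →ₗ[R] Z n)
    (D D' : ∀ n, Submodule R (C n)) : Prop where
  le : D ≤ D'
  map_le_comap : ∀ n, (D (n + 1)).map (p n) ≤ (D' n).comap (i n)
  comap_le_map : ∀ n, (D n).comap (i n) ≤ (D' (n + 1)).map (p n)
  isPureWithin_map : ∀ n, IsPureWithin ((D (n + 1)).map (p n)) ((D' (n + 1)).map (p n))

theorem IsSpliced.exists_isEnlargement (h : IsSpliced i p) (hκ : ℵ₀ ≤ κ)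
    (hZ : ∀ n, IsFlatML R (Z n)) (hH : ∀ n, IsHillFamily κ (H n)) {D : ∀ n, Submodule R (C n)}
    (hD : ∀ n, (D n).spanRank ≤ κ) :
    ∃ D', (∀ n, D' n ∈ H n ∧ (D' n).spanRank ≤ κ) ∧ IsEnlargement i p D D' := by
  have hcycles : ∀ n, ∃ T : Submodule R (Z n), (D n).comap (i n) ≤ T ∧ T.spanRank ≤ κ :=
    forall_int_of_forall_add_one fun n => (hZ n).exists_comap_le hκ (h.injective _) (h.exact n)
      (h.surjective n) (hD (n + 1))
  choose T hT hTκ using hcycles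
  have hmap (n : ℤ) : ((D (n + 1)).map (p n)).spanRank ≤ κ :=
    (Submodule.spanRank_map_le _ _).trans (hD _)
  choose P hPκ hP using fun n => (hZ n).exists_isPureWithin hκ (hmap n)
  choose U hU hUκ using fun n =>
    exists_map_eq_of_spanRank_le (h.surjective n) (spanRank_sup_le hκ (hTκ n) (hPκ n))
  obtain ⟨V, hV⟩ := exists_forall_add_one_eq (X := fun n => Submodule R (C n)) U
  have hVκ : ∀ n, (V n).spanRank ≤ κ := forall_int_of_forall_add_one fun n => hV n ▸ hUκ n
  choose D' hD'H hD' hD'κ using fun n => (hH n).exists_ge hκ (spanRank_sup_le hκ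
    (spanRank_sup_le hκ (hD n) ((Submodule.spanRank_map_le (i n) _).trans (hmap n))) (hVκ n))
  have hle (n : ℤ) : T n ⊔ P n ≤ (D' (n + 1)).map (p n) :=
    (hU n).symm.trans_le (Submodule.map_mono (hV n ▸ le_sup_right.trans (hD' (n + 1))))
  exact ⟨D', fun n => ⟨hD'H n, hD'κ n⟩, {
    le := fun n => le_sup_left.trans (le_sup_left.trans (hD' n))
    map_le_comap := fun n =>
      Submodule.map_le_iff_le_comap.1 (le_sup_right.trans (le_sup_left.trans (hD' n)))
    comap_le_map := fun n => (hT n).trans (le_sup_left.trans (hle n))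
    isPureWithin_map := fun n => (hP n).mono le_rfl (le_sup_right.trans (hle n)) }⟩

theorem IsSpliced.exists_seq_isEnlargement (h : IsSpliced i p) (hκ : ℵ₀ ≤ κ)
    (hZ : ∀ n, IsFlatML R (Z n)) (hH : ∀ n, IsHillFamily κ (H n)) {X : ∀ n, Submodule R (C n)}
    (hX : ∀ n, (X n).spanRank ≤ κ) :
    ∃ D : ℕ → ∀ n, Submodule R (C n), (∀ k n, D k n ∈ H n ∧ (D k n).spanRank ≤ κ) ∧ X ≤ D 0 ∧
      ∀ k, IsEnlargement i p (D k) (D (k + 1)) := by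
  choose! next hnext henl using fun (D : ∀ n, Submodule R (C n))
    (hD : ∀ n, (D n).spanRank ≤ κ) => h.exists_isEnlargement hκ hZ hH hD
  have hiterate (k : ℕ) : ∀ n, (next^[k + 1] X n) ∈ H n ∧ (next^[k + 1] X n).spanRank ≤ κ := by
    induction k with
    | zero => exact hnext X hX
    | succ k ih =>
      rw [Function.iterate_succ_apply']
      exact hnext _ fun n => (ih n).2
  refine ⟨fun k => next^[k + 1] X, hiterate, (henl X hX).le, fun k => ?_⟩
  dsimp only
  rw [Function.iterate_succ_apply' next (k + 1)]
  exact henl _ fun n => (hiterate k n).2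

theorem IsSpliced.exists_subsequence (h : IsSpliced i p) (hκ : ℵ₀ ≤ κ)
    (hZ : ∀ n, IsFlatML R (Z n)) (hH : ∀ n, IsHillFamily κ (H n)) {X : ∀ n, Submodule R (C n)}
    (hX : ∀ n, (X n).spanRank ≤ κ) :
    ∃ E : ∀ n, Submodule R (C n), X ≤ E ∧ ∀ n, E n ∈ H n ∧ (E n).spanRank ≤ κ ∧
      (E n).comap (i n) = (E (n + 1)).map (p n) ∧
      IsPureInjective ((E n).comap (i n)).subtype := by
  obtain ⟨D, hD, hXD, henl⟩ := h.exists_seq_isEnlargement hκ hZ hH hX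
  have hdir (n : ℤ) : Directed (· ≤ ·) fun k => D k n :=
    (monotone_nat_of_le_succ fun k => (henl k).le n).directed_le
  have hcomap (n : ℤ) : (⨆ k, D k n).comap (i n) = ⨆ k, (D k (n + 1)).map (p n) := by
    rw [comap_iSup_of_directed _ (hdir n)]
    exact le_antisymm
      (iSup_le fun k => le_iSup_of_le (k + 1) ((henl k).comap_le_map n))
      (iSup_le fun k => le_iSup_of_le (k + 1) ((henl k).map_le_comap n))
  refine ⟨fun n => ⨆ k, D k n, fun n => (hXD n).trans (le_iSup (fun k => D k n) 0),
    fun n => ⟨(hH n).sSup_mem _ (Set.range_subset_iff.2 fun k => (hD k n).1), ?_, ?_, ?_⟩⟩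
  · dsimp only
    rw [← Equiv.ulift.{u}.iSup_comp]
    exact spanRank_iSup_le hκ ((Cardinal.mk_le_aleph0).trans hκ) fun k => (hD k.down n).2
  · rw [hcomap, Submodule.map_iSup]
  · rw [hcomap]
    exact isPureInjective_subtype_iSup_of_isPureWithin fun k => (henl k).isPureWithin_map n

end Spliced

section Subsequences

variable {Z C : ℤ → Type u} [∀ n, AddCommGroup (Z n)] [∀ n, Module R (Z n)]
  [∀ n, AddCommGroup (C n)] [∀ n, Module R (C n)]
  {i : ∀ n, Z n →ₗ[R] C n} {p : ∀ n, C (n + 1) →ₗ[R] Z n}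
  {κ : Cardinal.{u}} {H : ∀ n, Set (Submodule R (C n))} {D : ∀ n, Submodule R (C n)}

theorem IsSpliced.quotient (h : IsSpliced i p)
    (hD : ∀ n, (D n).comap (i n) = (D (n + 1)).map (p n)) :
    IsSpliced (fun n => Submodule.mapQ ((D n).comap (i n)) (D n) (i n) le_rfl)
      (fun n => Submodule.mapQ (D (n + 1)) ((D n).comap (i n)) (p n)
        (Submodule.map_le_iff_le_comap.1 (hD n).ge)) where
  injective n := by
    rw [← LinearMap.ker_eq_bot, Submodule.ker_mapQ]
    exact Submodule.mkQ_map_self _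
  surjective n := .of_comp (g := (D (n + 1)).mkQ)
    ((Submodule.mkQ_surjective _).comp (h.surjective n))
  exact n := LinearMap.exact_iff.2 <| by
    rw [Submodule.ker_mapQ, hD n, Submodule.comap_map_eq, Submodule.map_sup,
      Submodule.mkQ_map_self, bot_sup_eq, (h.exact n).linearMap_ker_eq, Submodule.range_mapQ]

/-- A family of members `D n` of the Hill families `H n` which induces a subsequence of
`0 → Z (n + 1) → C (n + 1) → Z n → 0` whose cycles have flat quotients. -/
structure IsHillSubsequence (i : ∀ n, Z n →ₗ[R] C n) (p : ∀ n, C (n + 1) →ₗ[R] Z n)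
    (H : ∀ n, Set (Submodule R (C n))) (D : ∀ n, Submodule R (C n)) : Prop where
  mem : ∀ n, D n ∈ H n
  comap_eq_map : ∀ n, (D n).comap (i n) = (D (n + 1)).map (p n)
  flat_quotient : ∀ n, Module.Flat R (Z n ⧸ (D n).comap (i n))

theorem comap_mkQ_map_comap_mkQ {A B : Type u} [AddCommGroup A] [Module R A] [AddCommGroup B]
    [Module R B] (f : A →ₗ[R] B) {P : Submodule R A} {Q : Submodule R B} (hQ : Q = P.map f)
    (E : Submodule R (A ⧸ P)) :
    (E.map (Submodule.mapQ P Q f (Submodule.map_le_iff_le_comap.1 hQ.ge))).comap Q.mkQ =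
      (E.comap P.mkQ).map f := by
  conv_lhs => rw [← Submodule.map_comap_eq_of_surjective P.mkQ_surjective E]
  rw [← Submodule.map_comp, Submodule.mapQ_mkQ, Submodule.map_comp, Submodule.comap_map_mkQ,
    sup_eq_right, hQ]
  exact Submodule.map_mono (Submodule.le_comap_mkQ P E)

theorem flat_quotient_comap_mkQ {A : Type u} [AddCommGroup A] [Module R A] {P : Submodule R A}
    {Q : Submodule R (A ⧸ P)} [Module.Flat R ((A ⧸ P) ⧸ Q)] :
    Module.Flat R (A ⧸ Q.comap P.mkQ) := by
  have e := Submodule.quotientQuotientEquivQuotient P (Q.comap P.mkQ) (Submodule.le_comap_mkQ P Q)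
  rw [Submodule.map_comap_eq_of_surjective P.mkQ_surjective] at e
  exact Module.Flat.of_linearEquiv e.symm

/-- The part of `B / N` cut out by `P` is the factor `N ⊆ Q` of `B`, for the preimage `Q` of `P`. -/
noncomputable def factorComapMkQEquiv {B : Type u} [AddCommGroup B] [Module R B]
    (N : Submodule R B) (P : Submodule R (B ⧸ N)) :
    (P.comap N.mkQ ⧸ N.submoduleOf (P.comap N.mkQ)) ≃ₗ[R] P :=
  (Submodule.quotEquivOfEq _ _ (by
    ext x
    rw [LinearMap.mem_ker]
    exact (Subtype.ext_iff.trans (Submodule.Quotient.mk_eq_zero N)).symm)).trans <|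
  ((N.mkQ.submoduleMap (P.comap N.mkQ)).quotKerEquivOfSurjective
    (N.mkQ.submoduleMap_surjective _)).trans <|
  LinearEquiv.ofEq _ _ (Submodule.map_comap_eq_of_surjective N.mkQ_surjective P)

namespace IsHillSubsequence

theorem comap_mkQ (hH : ∀ n, IsHillFamily κ (H n)) (hD : IsHillSubsequence i p H D)
    {E : ∀ n, Submodule R (C n ⧸ D n)}
    (hE : IsHillSubsequence (fun n => Submodule.mapQ ((D n).comap (i n)) (D n) (i n) le_rfl)
      (fun n => Submodule.mapQ (D (n + 1)) ((D n).comap (i n)) (p n)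
        (Submodule.map_le_iff_le_comap.1 (hD.comap_eq_map n).ge))
      (fun n => Submodule.map (D n).mkQ '' H n) E) :
    IsHillSubsequence i p H fun n => (E n).comap (D n).mkQ where
  mem n := by
    obtain ⟨P, hP, hPE⟩ := hE.mem n
    rw [← hPE, Submodule.comap_map_mkQ]
    exact (hH n).sup_mem (hD.mem n) hP
  comap_eq_map n := by
    rw [← comap_mkQ_map_comap_mkQ _ (hD.comap_eq_map n), ← hE.comap_eq_map n]
    rfl
  flat_quotient n :=
    have := hE.flat_quotient n
    flat_quotient_comap_mkQ (P := (D n).comap (i n)) (Q := (E n).comap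
      (Submodule.mapQ ((D n).comap (i n)) (D n) (i n) le_rfl))

theorem exists_gt (h : IsSpliced i p) (hκ : ℵ₀ ≤ κ) (hH : ∀ n, IsHillFamily κ (H n))
    (hD : IsHillSubsequence i p H D) (hne : D ≠ ⊤) :
    ∃ D', IsHillSubsequence i p H D' ∧ D < D' ∧ ∀ n,
      presentedFlatML R κ (ModuleCat.of R ((D' n).comap (i n) ⧸
        ((D n).comap (i n)).submoduleOf ((D' n).comap (i n)))) := by
  classical
  have hquot := h.quotient hD.comap_eq_map
  have hflat := hD.flat_quotient
  have hZ := hquot.isFlatML hflat fun n => (hH n).isFlatML_quotient _ (hD.mem n)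
  obtain ⟨m, hm⟩ := Function.ne_iff.1 hne
  obtain ⟨c, hc⟩ : ∃ c, c ∉ D m := by simpa [Submodule.eq_top_iff'] using hm
  obtain ⟨E, hcE, hE⟩ := hquot.exists_subsequence hκ hZ (fun n => (hH n).quotient (hD.mem n))
    (X := fun n => R ∙ (D n).mkQ (Pi.single m c n)) fun n =>
      (Submodule.spanRank_span_le_card _).trans ((Cardinal.mk_singleton _).trans_le
        (Cardinal.one_le_aleph0.trans hκ))
  choose hEH hEκ hEmap hEpure using hE
  have hle : D ≤ fun n => (E n).comap (D n).mkQ := fun n => Submodule.le_comap_mkQ _ _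
  refine ⟨fun n => (E n).comap (D n).mkQ, hD.comap_mkQ hH ⟨hEH, hEmap, fun n => ?_⟩,
    lt_of_le_not_ge hle fun hge => hc (hge m ?_), fun n => ?_⟩
  · exact isPureInjective_subtype_iff_flat_quotient.1 (hEpure n)
  · have hmem := hcE m (Submodule.mem_span_singleton_self _)
    rwa [Pi.single_eq_same] at hmem
  · have hgen : (⊤ : Submodule R ((E n).comap
        (Submodule.mapQ ((D n).comap (i n)) (D n) (i n) le_rfl))).spanRank ≤ κ := by
      rw [Submodule.spanRank_top, hEmap n]
      exact (Submodule.spanRank_map_le _ _).trans (hEκ (n + 1))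
    have hML := (hZ n).of_isPureInjective (hEpure n)
    have e := factorComapMkQEquiv ((D n).comap (i n)) ((E n).comap
      (Submodule.mapQ ((D n).comap (i n)) (D n) (i n) le_rfl))
    exact ⟨(hML.isLEPresented hκ hgen).of_equiv e, hML.of_equiv e⟩

theorem bot (h : IsSpliced i p) (hZ : ∀ n, Module.Flat R (Z n))
    (hH : ∀ n, IsHillFamily κ (H n)) : IsHillSubsequence i p H ⊥ := by
  have hbot (n : ℤ) : (⊥ : Submodule R (C n)).comap (i n) = ⊥ :=
    LinearMap.ker_eq_bot.2 (h.injective n)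
  refine ⟨fun n => (hH n).bot_mem, fun n => ?_, fun n => ?_⟩
  · simp only [Pi.bot_apply, hbot, Submodule.map_bot]
  · have := hZ n
    exact Module.Flat.of_linearEquiv (Submodule.quotEquivOfEqBot _ (hbot n))

theorem iSup (hZ : ∀ n, Module.Flat R (Z n)) (hH : ∀ n, IsHillFamily κ (H n)) {ι : Type*}
    [Nonempty ι] {D : ι → ∀ n, Submodule R (C n)} (hdir : Directed (· ≤ ·) D)
    (hD : ∀ a, IsHillSubsequence i p H (D a)) : IsHillSubsequence i p H (⨆ a, D a) := by
  have hdir' (n : ℤ) : Directed (· ≤ ·) fun a => D a n := fun a b =>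
    let ⟨c, hac, hbc⟩ := hdir a b
    ⟨c, hac n, hbc n⟩
  have hcomap (n : ℤ) : ((⨆ a, D a) n).comap (i n) = ⨆ a, (D a n).comap (i n) := by
    rw [iSup_apply, comap_iSup_of_directed _ (hdir' n)]
  refine ⟨fun n => ?_, fun n => ?_, fun n => ?_⟩
  · rw [iSup_apply]
    exact (hH n).sSup_mem _ (Set.range_subset_iff.2 fun a => (hD a).mem n)
  · rw [hcomap, iSup_apply, Submodule.map_iSup]
    exact iSup_congr fun a => (hD a).comap_eq_map n
  · have := hZ n
    rw [hcomap, ← isPureInjective_subtype_iff_flat_quotient]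
    exact isPureInjective_subtype_iSup
      ((hdir' n).mono_comp (· ≤ ·) fun _ _ => Submodule.comap_mono) fun a =>
      isPureInjective_subtype_iff_flat_quotient.2 ((hD a).flat_quotient n)

end IsHillSubsequence

end Subsequences

section Iteration

theorem exists_transfinite_chain {L : Type u} [CompleteLattice L] {G : L → Prop}
    {r : L → L → Prop} (hbot : G ⊥)
    (hiSup : ∀ {ι : Type (u + 1)} [Nonempty ι] {f : ι → L}, Directed (· ≤ ·) f →
      (∀ a, G (f a)) → G (⨆ a, f a))
    (hnext : ∀ x, G x → x ≠ ⊤ → ∃ y, G y ∧ x < y ∧ r x y) :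
    ∃ (σ : Ordinal.{u}) (F : Ordinal.{u} → L), Monotone F ∧ F 0 = ⊥ ∧ F σ = ⊤ ∧
      (∀ β, Order.IsSuccLimit β → F β = ⨆ α : Set.Iio β, F α) ∧
      ∀ α < σ, r (F α) (F (Order.succ α)) := by
  classical
  choose next hnextG hnextlt hnextr using hnext
  let φ (x : L) : L := if h : G x ∧ x ≠ ⊤ then next x h.1 h.2 else ⊤
  have hφ {x : L} (hx : G x) (hne : x ≠ ⊤) : φ x = next x hx hne := dif_pos ⟨hx, hne⟩
  have hφtop : φ ⊤ = ⊤ := dif_neg fun h => h.2 rfl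
  have hφlt (x : L) (hne : x ≠ ⊤) : x < φ x := by
    by_cases hx : G x
    · exact (hφ hx hne).symm ▸ hnextlt x hx hne
    · simpa only [φ, hx, false_and, dite_false] using lt_top_iff_ne_top.2 hne
  have hφG {x : L} (hx : G x) : G (φ x) := by
    by_cases hne : x = ⊤
    · rwa [hne, hφtop, ← hne]
    · exact (hφ hx hne).symm ▸ hnextG x hx hne
  have hmono : Monotone fun α : Ordinal.{u} => transfiniteIterate φ α (⊥ : L) :=
    monotone_transfiniteIterate φ ⊥ fun x =>
      (eq_or_ne x ⊤).elim (fun hx => hx ▸ hφtop.ge) fun hne => (hφlt x hne).le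
  have hsucc (α : Ordinal.{u}) := transfiniteIterate_succ φ ⊥ α (not_isMax α)
  have hlim (β : Ordinal.{u}) (hβ : Order.IsSuccLimit β) := transfiniteIterate_limit φ ⊥ β hβ
  have hG (α : Ordinal.{u}) : G (transfiniteIterate φ α ⊥) := by
    induction α using SuccOrder.limitRecOn with
    | isMin α hmin => rwa [hmin.eq_bot, transfiniteIterate_bot]
    | succ α _ ih => exact hsucc α ▸ hφG ih
    | isSuccLimit β hβ ih =>
      have : Nonempty (Set.Iio β) := ⟨⟨0, hβ.bot_lt⟩⟩
      rw [hlim β hβ]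
      exact hiSup (Monotone.directed_le fun a b hab => hmono hab) fun a => ih a.1 a.2
  have htop : ∃ σ : Ordinal.{u}, transfiniteIterate φ σ (⊥ : L) = ⊤ :=
    top_mem_range_transfiniteIterate φ ⊥ hφlt hφtop (not_injective_of_ordinal _)
  obtain ⟨σ, hσ, hmin⟩ := WellFounded.has_min (wellFounded_lt (α := Ordinal.{u})) _ htop
  refine ⟨σ, _, hmono, transfiniteIterate_bot φ ⊥, hσ, hlim, fun α hα => ?_⟩
  have hne : transfiniteIterate φ α (⊥ : L) ≠ ⊤ := fun h => hmin α h hα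
  rw [hsucc, hφ (hG α) hne]
  exact hnextr _ _ hne

variable {Z C : ℤ → Type u} [∀ n, AddCommGroup (Z n)] [∀ n, Module R (Z n)]
  [∀ n, AddCommGroup (C n)] [∀ n, Module R (C n)]
  {i : ∀ n, Z n →ₗ[R] C n} {p : ∀ n, C (n + 1) →ₗ[R] Z n}

theorem IsSpliced.restrictedFlatML {κ : Cardinal.{u}} (h : IsSpliced i p)
    (hZ : ∀ n, Module.Flat R (Z n)) (hκ : ℵ₀ ≤ κ)
    (hC : ∀ n, ∃ H : Set (Submodule R (C n)), IsHillFamily κ H) (n : ℤ) :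
    restrictedFlatML R κ (ModuleCat.of R (Z n)) := by
  choose H hH using hC
  obtain ⟨σ, F, hmono, hzero, htop, hlim, hfac⟩ := exists_transfinite_chain
    (IsHillSubsequence.bot h hZ hH) (IsHillSubsequence.iSup hZ hH)
    fun _ hD hne => hD.exists_gt h hκ hH hne
  refine ⟨σ, fun α => (F α n).comap (i n),
    fun α _ β _ hαβ => Submodule.comap_mono (hmono hαβ n), ?_, ?_, fun β _ hβ => ?_,
    fun α hα => ⟨_, hfac α hα n, ⟨LinearEquiv.refl R _⟩⟩⟩
  · dsimp only
    rw [hzero]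
    exact LinearMap.ker_eq_bot.2 (h.injective n)
  · dsimp only
    rw [htop]
    exact Submodule.comap_top _
  · have : Nonempty (Set.Iio β) := ⟨⟨0, hβ.bot_lt⟩⟩
    dsimp only
    rw [hlim β hβ, iSup_apply]
    exact comap_iSup_of_directed _ (Monotone.directed_le fun _ _ hαβ => hmono hαβ n)

end Iteration

section RestrictedFlatML

variable {κ : Cardinal.{u}}

theorem filt_of_equiv {S : ObjectProperty (ModuleCat.{u} R)} {M M' : ModuleCat.{u} R}
    (hM : filt S M) (e : M ≃ₗ[R] M') : filt S M' := by
  obtain ⟨σ, F, hmono, hzero, htop, hlim, hfac⟩ := hM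
  refine ⟨σ, fun α => (F α).map e.toLinearMap,
    fun α hα β hβ hαβ => Submodule.map_mono (hmono hα hβ hαβ), ?_, ?_, fun β hβ hβ' => ?_,
    fun α hα => ?_⟩
  · simp [hzero]
  · simp [htop]
  · dsimp only
    rw [hlim β hβ hβ', Submodule.map_iSup]
  · obtain ⟨N, hN, ⟨e'⟩⟩ := hfac α hα
    have hle : F α ≤ F (Order.succ α) := hmono hα.le (Order.succ_le_of_lt hα) (Order.le_succ α)
    exact ⟨N, hN, ⟨(factorMapEquiv e.toLinearMap hle (by simp)).symm.trans e'⟩⟩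

theorem restrictedFlatML_of_isPeriodic (hκ : ℵ₀ ≤ κ) {M : ModuleCat.{u} R}
    (hM : flatModules R M) (hper : IsPeriodic (restrictedFlatML R κ) M) :
    restrictedFlatML R κ M := by
  obtain ⟨C, f, g, hC, hf, hfg, hg⟩ := hper
  have h : IsSpliced (Z := fun _ => M) (C := fun _ => C) (fun _ => f) (fun _ => g) :=
    ⟨fun _ => hf, fun _ => hg, fun _ => hfg⟩
  exact h.restrictedFlatML (fun _ => hM) hκ (fun _ => exists_isHillFamily hκ hC) 0

theorem isSpliced_of_isCompl {M : Type u} [AddCommGroup M] [Module R M] {K : ℤ → Submodule R M}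
    (hK : ∀ n, IsCompl (K n) (K (n + 1))) :
    IsSpliced (fun n => (K n).subtype) (C := fun _ => M)
      (fun n => (K n).projectionOnto (K (n + 1)) (hK n)) where
  injective n := (K n).injective_subtype
  surjective n := Submodule.projectionOnto_surjective _
  exact n := LinearMap.exact_iff.2 <| by
    rw [Submodule.ker_projectionOnto, Submodule.range_subtype]

/-- A direct summand is a cycle module of the `2`-periodic complex alternating between the
projections onto the summand and onto its complement. -/
theorem restrictedFlatML_of_isCompl {M : Type u} [AddCommGroup M] [Module R M]
    (hκ : ℵ₀ ≤ κ) {H : Set (Submodule R M)} (hH : IsHillFamily κ H) {P Q : Submodule R M}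
    (hPQ : IsCompl P Q) : restrictedFlatML R κ (ModuleCat.of R P) := by
  let K (n : ℤ) : Submodule R M := if Even n then P else Q
  have hK (n : ℤ) : IsCompl (K n) (K (n + 1)) := by
    by_cases hn : Even n <;> simp only [K, Int.even_add_one, hn, if_true, if_false, not_true,
      not_false_eq_true, hPQ, hPQ.symm]
  have := hH.isFlatML.1
  have hflat (n : ℤ) : Module.Flat R (K n) :=
    Module.Flat.of_retract (K n).subtype ((K n).projectionOnto _ (hK n))
      (Submodule.projectionOnto_comp_subtype _)
  exact (isSpliced_of_isCompl hK).restrictedFlatML hflat hκ (fun _ => ⟨H, hH⟩) 0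

theorem restrictedFlatML_of_projective (hκ : ℵ₀ ≤ κ) {M : ModuleCat.{u} R}
    (hM : Module.Projective R M) : restrictedFlatML R κ M := by
  obtain ⟨s, hs⟩ := Module.projective_def'.1 hM
  have hleft : Function.LeftInverse (Finsupp.linearCombination R id) s := LinearMap.congr_fun hs
  have hcompl := LinearMap.isCompl_of_proj
    (f := s.rangeRestrict ∘ₗ Finsupp.linearCombination R id) <| by
      rintro ⟨_, x, rfl⟩
      exact Subtype.ext (congrArg s (hleft x))
  exact filt_of_equiv (restrictedFlatML_of_isCompl hκ (isHillFamily_supported hκ) hcompl)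
    (LinearEquiv.ofInjective s hleft.injective).symm

theorem projective_of_restrictedFlatML_aleph0 {M : ModuleCat.{u} R}
    (hM : restrictedFlatML R ℵ₀ M) : Module.Projective R M := by
  obtain ⟨σ, F, hmono, hzero, htop, hlim, hfac⟩ := hM
  have h : IsContinuousChain σ F := ⟨hmono, hzero, hlim⟩
  refine h.projective htop fun α hα => ?_
  obtain ⟨N, hN, ⟨e⟩⟩ := hfac α hα
  have : Module.Projective R N := IsFlatML.projective_of_isLEPresented hN.2 hN.1
  exact Module.Projective.of_equiv e.symm

theorem restrictedFlatML_aleph0_eq (R : Type u) [CommRing R] :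
    restrictedFlatML R ℵ₀ = projectiveModules R := by
  ext M
  exact ⟨projective_of_restrictedFlatML_aleph0, restrictedFlatML_of_projective le_rfl⟩

end RestrictedFlatML

section Complexes

theorem IsSpliced.exists_contraction {Z C : ℤ → Type u} [∀ n, AddCommGroup (Z n)]
    [∀ n, Module R (Z n)] [∀ n, AddCommGroup (C n)] [∀ n, Module R (C n)]
    {i : ∀ n, Z n →ₗ[R] C n} {p : ∀ n, C (n + 1) →ₗ[R] Z n} (h : IsSpliced i p)
    (hZ : ∀ n, Module.Projective R (Z n)) :
    ∃ k : ∀ n, C n →ₗ[R] C (n + 1),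
      ∀ n x, k n (i n (p n x)) + i (n + 1) (p (n + 1) (k (n + 1) x)) = x := by
  choose s hs using fun n => have := hZ n
    Module.projective_lifting_property (p n) LinearMap.id (h.surjective n)
  have hps (n : ℤ) (z : Z n) : p n (s n z) = z := LinearMap.congr_fun (hs n) z
  have hmem (n : ℤ) (x : C (n + 1)) : x - s n (p n x) ∈ LinearMap.range (i (n + 1)) :=
    (h.exact n _).1 (by rw [map_sub, hps, sub_self])
  obtain ⟨ρ, hρ⟩ := exists_forall_add_one_eq (X := fun n => C n →ₗ[R] Z n) fun n =>
    LinearMap.codRestrictOfInjective (LinearMap.id - s n ∘ₗ p n) (i (n + 1)) (h.injective _)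
      (hmem n)
  have hiρ (n : ℤ) (x : C (n + 1)) : i (n + 1) (ρ (n + 1) x) = x - s n (p n x) := by
    rw [hρ, LinearMap.codRestrictOfInjective_comp_apply]
    rfl
  have hρi : ∀ n z, ρ n (i n z) = z := forall_int_of_forall_add_one fun n z =>
    h.injective _ (by rw [hiρ, (h.exact n).apply_apply_eq_zero, map_zero, sub_zero])
  refine ⟨fun n => s n ∘ₗ ρ n, fun n x => ?_⟩
  simp only [LinearMap.comp_apply, hρi, hps, hiρ, add_sub_cancel]

variable (C : ChainComplex (ModuleCat.{u} R) ℤ)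

theorem mem_cycles_iff {n m : ℤ} (h : m + 1 = n) (x : C.X n) :
    x ∈ RestrictedFlatML.cycles C n ↔ (C.d n m).hom x = 0 := by
  obtain rfl : m = n - 1 := by omega
  exact LinearMap.mem_ker

/-- The differential of `C`, corestricted to the cycles. -/
noncomputable def toCycles (n : ℤ) : C.X (n + 1) →ₗ[R] RestrictedFlatML.cycles C n :=
  (C.d (n + 1) n).hom.codRestrict _ fun x => by
    rw [mem_cycles_iff C (sub_add_cancel n 1), ← LinearMap.comp_apply, ← ModuleCat.hom_comp,
      C.d_comp_d]
    rfl

variable {C}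

theorem isSpliced_cycles (hC : C.Acyclic) :
    IsSpliced (fun n => (RestrictedFlatML.cycles C n).subtype) (toCycles C) where
  injective _ := Subtype.val_injective
  surjective n := by
    rintro ⟨x, hx⟩
    have hex := hC n
    rw [HomologicalComplex.exactAt_iff' C (n + 1) n (n - 1) (by simp) (by simp),
      ShortComplex.moduleCat_exact_iff] at hex
    obtain ⟨y, hy⟩ := hex x hx
    exact ⟨y, Subtype.ext hy⟩
  exact n x := by
    rw [Submodule.coe_subtype, Subtype.range_coe]
    exact Subtype.ext_iff.trans (mem_cycles_iff C rfl x).symm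

theorem restrictedFlatML_cycles {κ : Cardinal.{u}} (hκ : ℵ₀ ≤ κ) (hC : IsPureAcyclic C)
    (hX : ∀ n, restrictedFlatML R κ (C.X n)) (n : ℤ) :
    restrictedFlatML R κ (ModuleCat.of R (RestrictedFlatML.cycles C n)) := by
  have h := isSpliced_cycles hC.1
  choose H hH using fun m => exists_isHillFamily hκ (hX m)
  refine h.restrictedFlatML (fun m => ?_) hκ (fun m => ⟨H m, hH m⟩) n
  have := (hH (m + 1)).isFlatML.1
  exact flat_of_isPureInjective (isPureSubmodule_iff.1 (hC.2 (m + 1))) (h.exact m) (h.surjective m)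

theorem nonempty_homotopy_zero_of_projective_cycles (hC : C.Acyclic)
    (hproj : ∀ n, Module.Projective R (RestrictedFlatML.cycles C n)) :
    Nonempty (Homotopy (𝟙 C) 0) := by
  obtain ⟨k, hk⟩ := (isSpliced_cycles hC).exists_contraction hproj
  let k' (a b : ℤ) (hab : (ComplexShape.down ℤ).Rel b a) : C.X a ⟶ C.X b :=
    hab ▸ ModuleCat.ofHom (k a)
  refine ⟨(Homotopy.ofEq (HomologicalComplex.hom_ext _ _ ?_)).trans (Homotopy.nullHomotopy' k')⟩
  refine forall_int_of_forall_add_one fun n => ?_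
  rw [Homotopy.nullHomotopicMap'_f (k₂ := n + 1 + 1) (k₁ := n + 1) (k₀ := n) rfl rfl]
  ext x : 2
  exact (hk n x).symm

end Complexes

end RestrictedFlatML

open RestrictedFlatML in
theorem mainTheorem5 (R : Type u) [CommRing R] :
    (∀ κ : Cardinal.{u}, ℵ₀ ≤ κ →
      (∀ M : ModuleCat.{u} R, flatModules R M → IsPeriodic (restrictedFlatML R κ) M →
        restrictedFlatML R κ M) ∧
      (∀ C : ChainComplex (ModuleCat.{u} R) ℤ, IsPureAcyclic C →
        (∀ n, restrictedFlatML R κ (C.X n)) →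
        ∀ n, restrictedFlatML R κ (ModuleCat.of R (RestrictedFlatML.cycles C n)))) ∧
    restrictedFlatML R ℵ₀ = projectiveModules R ∧
    (∀ M : ModuleCat.{u} R, flatModules R M → IsPeriodic (projectiveModules R) M →
      projectiveModules R M) ∧
    (∀ C : ChainComplex (ModuleCat.{u} R) ℤ, IsPureAcyclic C →
      (∀ n, projectiveModules R (C.X n)) →
      (∀ n, projectiveModules R (ModuleCat.of R (RestrictedFlatML.cycles C n))) ∧
      Nonempty (Homotopy (𝟙 C) 0)) := by
  refine ⟨fun κ hκ => ⟨fun M => restrictedFlatML_of_isPeriodic hκ,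
    fun C hC hX => restrictedFlatML_cycles hκ hC hX⟩, restrictedFlatML_aleph0_eq R, ?_, ?_⟩
  · rw [← restrictedFlatML_aleph0_eq]
    exact fun M => restrictedFlatML_of_isPeriodic le_rfl
  · intro C hC hX
    have hcyc : ∀ n, projectiveModules R (ModuleCat.of R (RestrictedFlatML.cycles C n)) := by
      rw [← restrictedFlatML_aleph0_eq] at hX ⊢
      exact restrictedFlatML_cycles le_rfl hC hX
    exact ⟨hcyc, nonempty_homotopy_zero_of_projective_cycles hC.1 hcyc⟩
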